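/- Setting. Let $\mathcal H$ be a real separable infinite-dimensional Hilbert space with orthonormal basis $(\phi_j)_{j\ge1}$, write $x_j=\langle x,\phi_j\rangle$, and let $\mathcal C$ be a bounded linear operator on $\mathcal H$ with $\mathcal C\phi_j=\lambda_j^2\phi_j$, $\lambda_j>0$. For $s\ge 0$ let $\mathcal H^s=\{x\in\mathcal H:\|x\|_s^2:=\sum_j j^{2s}x_j^2<\infty\}$, and let $\|\cdot\|_{-s}$ be the norm of its dual $\mathcal H^{-s}=\mathcal L(\mathcal H^s,\mathbb R)$. Let $\Psi:\mathcal H^s\to\mathbb R$. Assumption 1. (i) There is $\kappa>\tfrac12$ with $\lambda_j\asymp j^{-\kappa}$; (ii) $0\le s<\kappa-\tfrac12$; (iii) $\Psi$ is differentiable on $\mathcal H^s$, and there is $K$ such that $\|\nabla\Psi(x)\|_{-s}\le K$ and $\|\nabla\Psi(x)-\nabla\Psi(y)\|_{-s}\le K\|x-y\|_s$ for all $x,y\in\mathcal H^s$. The algorithm. Let $X^N=\mathrm{span}\{\phi_1,\dots,\phi_N\}\cong\mathbb R^N$ with projection $\mathcal P^N$, $\Psi^N=\Psi\circ\mathcal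 P^N$, $\nabla\Psi^N=\mathcal P^N\circ\nabla\Psi\circ\mathcal P^N$, $\mathcal C_N=\mathcal P^N\mathcal C\mathcal P^N$, and $\|x\|_{\mathcal C_N}^2=\sum_{j=1}^N x_j^2/\lambda_j^2$ on $X^N$. Fix $\ell>0$ and put $\delta=\ell/\sqrt N$. For $x,y\in X^N$ let $$\pi^N(x)\propto e^{-\frac12\|x\|_{\mathcal C_N}^2-\Psi^N(x)},\qquad q^N(x,y)\propto e^{-\frac1{4\delta}\|y-x+\delta(x+\mathcal C_N\nabla\Psi^N(x))\|_{\mathcal C_N}^2},\qquad \alpha^N(x,y)=1\wedge\frac{\pi^N(y)\,q^N(y,x)}{\pi^N(x)\,q^N(x,y)}.$$ Given $x^0\in\mathcal H^s$, the MALA chain is defined by $x^{0,N}=\mathcal P^N x^0$ and, for $k\ge 0$, $$y^{k,N}=x^{k,N}-\delta\bigl(x^{k,N}+\mathcal C_N\nabla\Psi^N(x^{k,N})\bigr)+\sqrt{2\delta}\,\mathcal C_N^{1/2}\xi^{k,N},\qquad x^{k+1,N}=\begin{cases}y^{k,N}&\text{if }U^{k,N}\le\alpha^N(x^{k,N},y^{k,N}),\\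 x^{k,N}&\text{otherwise,}\end{cases}$$ where $\xi^{k,N}=\sum_{j=1}^N\xi^{k,N}_j\phi_j$ and, for each fixed $N$, the variables $\xi^{k,N}_j\sim\mathcal N(0,1)$ and $U^{k,N}\sim\mathrm{Uniform}[0,1]$ ($k\ge0$, $1\le j\le N$) are all independent. Put $$S^{k,N}=\frac1N\sum_{i=1}^N\frac{|x_i^{k,N}|^2}{\lambda_i^2},\qquad \alpha_\ell(\sigma)=1\wedge e^{\ell^2(\sigma-1)/2}.$$ Proposition. Suppose that Assumption 1 holds and that $x^0\in\mathcal H^s$ is such that $\lim_{N\to\infty}\frac1N\sum_{i=1}^N|x^0_i|^2/\lambda_i^2$ exists and is finite. Then $|\alpha^N(x^{k,N},y^{k,N})-\alpha_\ell(S^{k,N})|^2$ is integrable for all $N$ and $k$, and for every $T>0$ $$\lim_{N\to\infty}\ \sup_{0\le k\le\lfloor T\sqrt N\rfloor}\ \mathbb E_{x^0}\left|\alpha^N(x^{k,N},y^{k,N})-\alpha_\ell(S^{k,N})\right|^2=0 .$$ In particular, the expectation tends to $0$ for every fixed $k$. -/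

import Mathlib

open Filter Topology MeasureTheory ProbabilityTheory
open scoped RealInnerProductSpace

noncomputable section

namespace MALA

/-! ### The Sobolev-like spaces `H^s`

Throughout, the paper's index `j = 1, 2, …` is `j + 1` for a Lean index `j = 0, 1, …`. -/

section Sobolev

variable {H : Type*} [NormedAddCommGroup H] [InnerProductSpace ℝ H]

theorem summable_iff_memlp (φ : HilbertBasis ℕ ℝ H) (s : ℝ) (x : H) :
    (Summable fun j : ℕ => ((j : ℝ) + 1) ^ (2 * s) * ⟪φ j, x⟫ ^ 2) ↔
      Memℓp (fun j : ℕ => ((j : ℝ) + 1) ^ s * ⟪φ j, x⟫) 2 := by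
  rw [memℓp_gen_iff (by norm_num)]
  refine summable_congr fun j => ?_
  have h : (0 : ℝ) ≤ (j : ℝ) + 1 := by positivity
  rw [mul_comm 2 s, Real.rpow_mul h]
  simp [mul_pow]

/-- The set `{x ∈ H : ∑ j^{2s} ⟨x, φ_j⟩² < ∞}`, as a linear subspace of `H`. -/
def hsSubmodule (φ : HilbertBasis ℕ ℝ H) (s : ℝ) : Submodule ℝ H where
  carrier := {x | Summable fun j : ℕ => ((j : ℝ) + 1) ^ (2 * s) * ⟪φ j, x⟫ ^ 2}
  zero_mem' := by simp
  add_mem' := by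
    intro x y hx hy
    simp only [Set.mem_ofPred_eq, summable_iff_memlp] at *
    convert hx.add hy using 1
    funext j
    simp [inner_add_right, mul_add]
  smul_mem' := by
    intro c x hx
    simp only [Set.mem_ofPred_eq, summable_iff_memlp] at *
    convert hx.const_smul c using 1
    funext j
    simp [inner_smul_right]
    ring

/-- The space `H^s` (for `s ≥ 0`). It is a type of its own, since its norm is not that of `H`. -/
def Hs (φ : HilbertBasis ℕ ℝ H) (s : ℝ) : Type _ := hsSubmodule φ s

instance (φ : HilbertBasis ℕ ℝ H) (s : ℝ) : AddCommGroup (Hs φ s) :=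
  inferInstanceAs (AddCommGroup (hsSubmodule φ s))

instance (φ : HilbertBasis ℕ ℝ H) (s : ℝ) : Module ℝ (Hs φ s) :=
  inferInstanceAs (Module ℝ (hsSubmodule φ s))

/-- The inclusion `H^s ⊆ H`. -/
def Hs.toH (φ : HilbertBasis ℕ ℝ H) (s : ℝ) : Hs φ s →ₗ[ℝ] H := (hsSubmodule φ s).subtype

/-- The coordinate `x_j = ⟨x, φ_j⟩`. -/
def Hs.coord {φ : HilbertBasis ℕ ℝ H} {s : ℝ} (x : Hs φ s) (j : ℕ) : ℝ :=
  ⟪φ j, Hs.toH φ s x⟫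

/-- The map `x ↦ (j^s x_j)_j` into `ℓ²`, through which the norm of `H^s` is defined. -/
def Hs.toL2 (φ : HilbertBasis ℕ ℝ H) (s : ℝ) : Hs φ s →ₗ[ℝ] lp (fun _ : ℕ => ℝ) 2 where
  toFun x := ⟨fun j => ((j : ℝ) + 1) ^ s * x.coord j, (summable_iff_memlp φ s _).1 x.2⟩
  map_add' x y := by
    ext j
    change ((j : ℝ) + 1) ^ s * ⟪φ j, Hs.toH φ s (x + y)⟫ =
      ((j : ℝ) + 1) ^ s * ⟪φ j, Hs.toH φ s x⟫ + ((j : ℝ) + 1) ^ s * ⟪φ j, Hs.toH φ s y⟫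
    rw [map_add, inner_add_right, mul_add]
  map_smul' c x := by
    ext j
    change ((j : ℝ) + 1) ^ s * ⟪φ j, Hs.toH φ s (c • x)⟫ =
      c * (((j : ℝ) + 1) ^ s * ⟪φ j, Hs.toH φ s x⟫)
    rw [map_smul, inner_smul_right]
    ring

theorem Hs.toL2_injective (φ : HilbertBasis ℕ ℝ H) (s : ℝ) :
    Function.Injective (Hs.toL2 φ s) := by
  refine (injective_iff_map_eq_zero _).2 fun x hx => ?_
  have h : ∀ j, ⟪φ j, Hs.toH φ s x⟫ = 0 := fun j => by
    have h1 := congrArg (fun f : lp (fun _ : ℕ => ℝ) 2 => f j) hx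
    have h2 : (((j : ℝ) + 1) ^ s) ≠ 0 := (Real.rpow_pos_of_pos (by positivity) s).ne'
    have h3 : ((j : ℝ) + 1) ^ s * ⟪φ j, Hs.toH φ s x⟫ = 0 := h1
    exact (mul_eq_zero.1 h3).resolve_left h2
  have h4 : φ.repr (Hs.toH φ s x) = 0 := by
    ext j
    simpa [HilbertBasis.repr_apply_apply] using h j
  have h5 : Hs.toH φ s x = 0 := by simpa using h4
  exact Subtype.ext h5

instance (φ : HilbertBasis ℕ ℝ H) (s : ℝ) : NormedAddCommGroup (Hs φ s) :=
  NormedAddCommGroup.induced (Hs φ s) (lp (fun _ : ℕ => ℝ) 2) (Hs.toL2 φ s)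
    (Hs.toL2_injective φ s)

instance (φ : HilbertBasis ℕ ℝ H) (s : ℝ) : NormedSpace ℝ (Hs φ s) :=
  NormedSpace.induced ℝ (Hs φ s) (lp (fun _ : ℕ => ℝ) 2) (Hs.toL2 φ s)

/-- The norm of `H^s` is `‖x‖_s² = ∑ j^{2s} x_j²`. -/
theorem Hs.norm_sq_eq {φ : HilbertBasis ℕ ℝ H} {s : ℝ} (x : Hs φ s) :
    ‖x‖ ^ 2 = ∑' j : ℕ, ((j : ℝ) + 1) ^ (2 * s) * x.coord j ^ 2 := by
  have h1 : ‖x‖ = ‖Hs.toL2 φ s x‖ := rfl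
  have h2 := lp.norm_rpow_eq_tsum (p := 2) (by norm_num) (Hs.toL2 φ s x)
  simp only [ENNReal.toReal_ofNat, Real.rpow_ofNat] at h2
  rw [h1, h2]
  refine tsum_congr fun j => ?_
  have h : (0 : ℝ) ≤ (j : ℝ) + 1 := by positivity
  rw [mul_comm 2 s, Real.rpow_mul h]
  simp [Hs.toL2, mul_pow]

theorem basis_mem (φ : HilbertBasis ℕ ℝ H) (s : ℝ) (i : ℕ) : φ i ∈ hsSubmodule φ s := by
  refine summable_of_ne_finset_zero (s := {i}) fun j hj => ?_
  have hji : j ≠ i := by simpa using hj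
  simp [φ.orthonormal.2 hji]

/-- The basis vector `φ_j`, as an element of `H^s`. -/
def Hs.basis (φ : HilbertBasis ℕ ℝ H) (s : ℝ) (j : ℕ) : Hs φ s := ⟨φ j, basis_mem φ s j⟩

end Sobolev

/-! ### The target measure -/

/-- The data of the problem: the orthonormal basis `φ_j` of `H`, the covariance operator `C` with
`C φ_j = λ_j² φ_j`, the exponent `s`, and the functional `Ψ` on `H^s`; the target measure has
density proportional to `exp (-Ψ)` with respect to `N(0, C)`. -/
structure Model (H : Type*) [NormedAddCommGroup H] [InnerProductSpace ℝ H] where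
  φ : HilbertBasis ℕ ℝ H
  C : H →L[ℝ] H
  lam : ℕ → ℝ
  lam_pos : ∀ j, 0 < lam j
  eigen : ∀ j, C (φ j) = (lam j ^ 2) • φ j
  s : ℝ
  Ψ : Hs φ s → ℝ

variable {H : Type*} [NormedAddCommGroup H] [InnerProductSpace ℝ H]

namespace Model

/-- The assumptions on `C` and `Ψ`. The derivative of `Ψ` at `x` is an element of the dual of `H^s`,
which is `H^{-s}`, and its operator norm is the norm `‖∇Ψ(x)‖_{-s}`. -/
structure Assumption (M : Model H) : Prop where
  decay : ∃ κ : ℝ, 1 / 2 < κ ∧ 0 ≤ M.s ∧ M.s < κ - 1 / 2 ∧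
    ∃ c₁ c₂ : ℝ, 0 < c₁ ∧ ∀ j : ℕ,
      c₁ * ((j : ℝ) + 1) ^ (-κ) ≤ M.lam j ∧ M.lam j ≤ c₂ * ((j : ℝ) + 1) ^ (-κ)
  differentiable : Differentiable ℝ M.Ψ
  bounded : ∃ K : ℝ, ∀ x, ‖fderiv ℝ M.Ψ x‖ ≤ K
  lipschitz : ∃ K : ℝ, ∀ x y, ‖fderiv ℝ M.Ψ x - fderiv ℝ M.Ψ y‖ ≤ K * ‖x - y‖

/-- The point `x⁰` of `H^s` lies in `H^s_∩`: the limit of `(1/N) ∑_{i ≤ N} x_i² / λ_i²` exists and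
is finite. -/
def InHsCap (M : Model H) (x : Hs M.φ M.s) : Prop :=
  ∃ S₀ : ℝ, Tendsto
    (fun N : ℕ => (1 / (N : ℝ)) * ∑ i : Fin N, x.coord i ^ 2 / M.lam i ^ 2) atTop (𝓝 S₀)

/-! ### The finite-dimensional objects

An element of `X^N = span {φ_1, …, φ_N}` is given by its coordinates, a vector `Fin N → ℝ`. -/

/-- The element `∑ v_i φ_i` of `H^s` with coordinate vector `v`. -/
def embed (M : Model H) {N : ℕ} (v : Fin N → ℝ) : Hs M.φ M.s :=
  ∑ i : Fin N, v i • Hs.basis M.φ M.s i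

/-- The projection `P^N`. -/
def proj (M : Model H) (N : ℕ) (x : Hs M.φ M.s) : Fin N → ℝ := fun i => x.coord i

/-- `Ψ^N = Ψ ∘ P^N`, on `X^N`. -/
def ΨN (M : Model H) {N : ℕ} (x : Fin N → ℝ) : ℝ := M.Ψ (M.embed x)

/-- `∇Ψ^N = P^N ∘ ∇Ψ ∘ P^N`: its `i`-th coordinate at `x` is the derivative of `Ψ` at `x` in the
direction `φ_i`. -/
def gradΨN (M : Model H) {N : ℕ} (x : Fin N → ℝ) : Fin N → ℝ :=
  fun i => fderiv ℝ M.Ψ (M.embed x) (Hs.basis M.φ M.s i)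

/-- `C_N = P^N ∘ C ∘ P^N`, on `X^N`. -/
def CN (M : Model H) {N : ℕ} (v : Fin N → ℝ) : Fin N → ℝ :=
  fun i => ⟪M.φ i, M.C (Hs.toH M.φ M.s (M.embed v))⟫

theorem CN_apply (M : Model H) {N : ℕ} (v : Fin N → ℝ) (i : Fin N) :
    M.CN v i = M.lam i ^ 2 * v i := by
  have h : ∀ j : ℕ, Hs.toH M.φ M.s (Hs.basis M.φ M.s j) = M.φ j := fun _ => rfl
  have h2 := orthonormal_iff_ite.1 M.φ.orthonormal
  simp only [CN, embed, map_sum, map_smul, h, M.eigen, inner_sum, inner_smul_right, h2]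
  rw [Finset.sum_eq_single i]
  · simp [mul_comm]
  · intro b _ hb
    have : (i : ℕ) ≠ b := fun h => hb (Fin.ext h.symm)
    simp [this]
  · simp

/-- The square root of `C_N`, the diagonal operator with entries `λ_i`. -/
def sqrtCN (M : Model H) {N : ℕ} (v : Fin N → ℝ) : Fin N → ℝ := fun i => M.lam i * v i

/-- `‖v‖_{C_N}² = ∑_{i ≤ N} v_i² / λ_i²`. -/
def normSqCN (M : Model H) {N : ℕ} (v : Fin N → ℝ) : ℝ := ∑ i : Fin N, v i ^ 2 / M.lam i ^ 2

/-- `S = (1/N) ∑_{i ≤ N} x_i² / λ_i²`. -/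
def S (M : Model H) {N : ℕ} (x : Fin N → ℝ) : ℝ :=
  (1 / (N : ℝ)) * ∑ i : Fin N, x i ^ 2 / M.lam i ^ 2

/-! ### The MALA algorithm -/

/-- The time step `δ = ℓ / √N`. -/
def step (ℓ : ℝ) (N : ℕ) : ℝ := ℓ / √(N : ℝ)

/-- The drift vector `x + C_N ∇Ψ^N(x)`, which is `-C_N ∇ log π^N(x)`. -/
def drift (M : Model H) {N : ℕ} (x : Fin N → ℝ) : Fin N → ℝ := x + M.CN (M.gradΨN x)

/-- The proposal `y = x - δ (x + C_N ∇Ψ^N(x)) + √(2δ) C_N^{1/2} ξ`. -/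
def proposal (M : Model H) (ℓ : ℝ) {N : ℕ} (x ξ : Fin N → ℝ) : Fin N → ℝ :=
  x - step ℓ N • M.drift x + √(2 * step ℓ N) • M.sqrtCN ξ

/-- The Lebesgue density of the target `π^N` on `X^N`, up to its normalization constant (which
cancels in the acceptance probability). -/
def targetDensity (M : Model H) {N : ℕ} (x : Fin N → ℝ) : ℝ :=
  Real.exp (-(1 / 2) * M.normSqCN x - M.ΨN x)

/-- The transition density `q^N(x, y)` of the proposal, up to its normalization constant (which does
not depend on `x` and `y`, and cancels in the acceptance probability). -/
def proposalDensity (M : Model H) (ℓ : ℝ) {N : ℕ} (x y : Fin N → ℝ) : ℝ :=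
  Real.exp (-(1 / (4 * step ℓ N)) * M.normSqCN (y - x + step ℓ N • M.drift x))

/-- The Metropolis-Hastings acceptance probability `α^N(x, y)`. -/
def accept (M : Model H) (ℓ : ℝ) {N : ℕ} (x y : Fin N → ℝ) : ℝ :=
  min 1 ((M.targetDensity y * M.proposalDensity ℓ y x) /
    (M.targetDensity x * M.proposalDensity ℓ x y))

/-- The MALA chain `x^{k,N}` started at `P^N x⁰` and driven by the Gaussian vectors `ξ k` and the
uniform variables `U k`: the proposal of step `k` is accepted when `U k ≤ α^N`. -/
def chain (M : Model H) (ℓ : ℝ) (x₀ : Hs M.φ M.s) {N : ℕ} {Ω : Type*}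
    (ξ : ℕ → Fin N → Ω → ℝ) (U : ℕ → Ω → ℝ) : ℕ → Ω → (Fin N → ℝ)
  | 0, _ => M.proj N x₀
  | k + 1, ω =>
    let x := chain M ℓ x₀ ξ U k ω
    let y := M.proposal ℓ x (fun i => ξ k i ω)
    if U k ω ≤ M.accept ℓ x y then y else x

/-- The proposal `y^{k,N}` made at step `k`. -/
def chainProposal (M : Model H) (ℓ : ℝ) (x₀ : Hs M.φ M.s) {N : ℕ} {Ω : Type*}
    (ξ : ℕ → Fin N → Ω → ℝ) (U : ℕ → Ω → ℝ) (k : ℕ) (ω : Ω) : Fin N → ℝ :=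
  M.proposal ℓ (M.chain ℓ x₀ ξ U k ω) (fun i => ξ k i ω)

end Model

/-- The noise of the algorithm in dimension `N`: the variables `ξ k i` are standard Gaussian, the
variables `U k` are uniform on `[0, 1]`, and all of them are independent. -/
structure IsNoise {Ω : Type*} [MeasurableSpace Ω] (P : Measure Ω) {N : ℕ}
    (ξ : ℕ → Fin N → Ω → ℝ) (U : ℕ → Ω → ℝ) : Prop where
  gaussian : ∀ k i, HasLaw (ξ k i) (gaussianReal 0 1) P
  uniform : ∀ k, HasLaw (U k) (volume.restrict (Set.Icc (0 : ℝ) 1)) P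
  indep : iIndepFun (Sum.elim (fun p : ℕ × Fin N => ξ p.1 p.2) U) P

/-- The limiting acceptance probability `α_ℓ(s) = 1 ∧ exp (ℓ² (s - 1) / 2)`. -/
def limitAccept (ℓ s : ℝ) : ℝ := min 1 (Real.exp (ℓ ^ 2 * (s - 1) / 2))

end MALA

end

/-!
The acceptance probability is `1 ∧ exp L`, where `L` is the logarithm of the Metropolis-Hastings
ratio, and the limit is `1 ∧ exp L₀` with `L₀ = ℓ² (S - 1) / 2`. As `t ↦ 1 ∧ e^t` is `1`-Lipschitz
with values in `[0, 1]`, the squared error is at most `|L - L₀|`.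

In the coordinates `z_i = x_i / λ_i` the reference measure is standard Gaussian, and the quadratic
forms in `L` cancel up to `-(δ / 4) (‖w + g'‖² - ‖z + g‖²)`, where `w` is the proposal and `g`, `g'`
are the gradients `C^{1/2} ∇Ψ` at both points, which are bounded (`log_ratio_eq`). As
`‖w‖² - ‖z‖² ≈ 2δ (‖ξ‖² - ‖z‖²) ≈ 2δ (N - ‖z‖²)` and `δ² N = ℓ²`, its main part is `L₀`. What is left
is at most `O(√δ) (E(x) + R(x, ξ))` (`Model.Controlled.abs_accept_sub_le`), with the energy
`E(x) = 1 + δ² ‖z‖² + δ ‖x‖_s²` and a noise term `R` made of `‖ξ‖²`, `⟨z, ξ⟩²`, `(‖ξ‖² - N)²` and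
`‖C^{1/2} ξ‖_s²`.

It remains to bound the expected energy over `O(1/δ)` steps. Whether or not the proposal is accepted,
one step increases the energy by at most `O(δ) (E + R)` (`Model.Controlled.energy_proposal_le`). Since
`x^k` is independent of the noise of step `k`, the expectation of `R` is at most a constant times that
of `E` (`Model.Controlled.integral_noiseEnergy_le`): this uses the law of large numbers in the form
`E (‖ξ‖² - N)² = O(N)`, and that `C^{1/2} : H → H^s` is Hilbert-Schmidt as `s < κ - 1/2`. Thus the
expected energy grows by a factor `1 + O(δ)` per step and stays bounded for `k ≤ T √N`
(`Model.Controlled.integral_energy_chain_le`); initially it is bounded because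
`S^{0,N}` converges. The weight `δ` of `‖x‖_s²` in the energy is what makes this crude estimate
sufficient: the bound on `‖x^k‖_s²` is only of order `1/δ`, but this norm enters the error only through
the drift `δ x` of the proposal.
-/

namespace MALA
namespace Model

variable {H : Type*} [NormedAddCommGroup H] [InnerProductSpace ℝ H]

/-! ### Coordinates in `X^N` -/

theorem embed_add (M : Model H) {N : ℕ} (v w : Fin N → ℝ) :
    M.embed (v + w) = M.embed v + M.embed w := by
  simp [embed, add_smul, Finset.sum_add_distrib]

theorem embed_smul (M : Model H) {N : ℕ} (c : ℝ) (v : Fin N → ℝ) :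
    M.embed (c • v) = c • M.embed v := by
  simp [embed, Finset.smul_sum, smul_smul]

theorem embed_sub (M : Model H) {N : ℕ} (v w : Fin N → ℝ) :
    M.embed (v - w) = M.embed v - M.embed w := by
  simp [embed, sub_smul, Finset.sum_sub_distrib]

theorem coord_embed (M : Model H) {N : ℕ} (v : Fin N → ℝ) (j : ℕ) :
    (M.embed v).coord j = if h : j < N then v ⟨j, h⟩ else 0 := by
  have hb : ∀ j : ℕ, Hs.toH M.φ M.s (Hs.basis M.φ M.s j) = M.φ j := fun _ => rfl
  have h2 := orthonormal_iff_ite.1 M.φ.orthonormal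
  simp only [Hs.coord, embed, map_sum, map_smul, hb, inner_sum, inner_smul_right, h2]
  split_ifs with h
  · rw [Finset.sum_eq_single ⟨j, h⟩]
    · simp
    · intro b _ hb
      have : j ≠ b := fun h' => hb (Fin.ext h'.symm)
      simp [this]
    · simp
  · refine Finset.sum_eq_zero fun i _ => ?_
    have : j ≠ i := fun h' => h (h' ▸ i.2)
    simp [this]

theorem norm_sq_embed (M : Model H) {N : ℕ} (v : Fin N → ℝ) :
    ‖M.embed v‖ ^ 2 = ∑ i : Fin N, ((i : ℝ) + 1) ^ (2 * M.s) * v i ^ 2 := by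
  rw [Hs.norm_sq_eq, tsum_eq_sum (s := Finset.range N), Finset.sum_range]
  · simp [coord_embed]
  · intro j hj
    have : ¬ j < N := by simpa using hj
    simp [coord_embed, this]

theorem summable_norm_sq {φ : HilbertBasis ℕ ℝ H} {s : ℝ} (x : Hs φ s) :
    Summable fun j : ℕ => ((j : ℝ) + 1) ^ (2 * s) * x.coord j ^ 2 := x.2

theorem norm_embed_proj_le (M : Model H) (N : ℕ) (x : Hs M.φ M.s) :
    ‖M.embed (M.proj N x)‖ ≤ ‖x‖ := by
  refine le_of_sq_le_sq ?_ (norm_nonneg _)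
  rw [norm_sq_embed, Hs.norm_sq_eq]
  have := (summable_norm_sq x).sum_le_tsum (Finset.range N) (fun i _ => by positivity)
  rwa [Finset.sum_range] at this

/-- The coordinates `x_i / λ_i` of `x` in the basis `λ_i φ_i`, in which the reference measure
`N(0, C_N)` is the standard Gaussian measure. -/
noncomputable def white (M : Model H) {N : ℕ} (x : Fin N → ℝ) : EuclideanSpace ℝ (Fin N) :=
  WithLp.toLp 2 fun i => x i / M.lam i

/-- The vector `C_N^{1/2} ∇Ψ^N(x)`, which represents `C_N ∇Ψ^N(x)` in the coordinates of
`MALA.Model.white`. -/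
noncomputable def whiteGrad (M : Model H) {N : ℕ} (x : Fin N → ℝ) : EuclideanSpace ℝ (Fin N) :=
  WithLp.toLp 2 fun i => M.lam i * M.gradΨN x i

theorem normSqCN_eq (M : Model H) {N : ℕ} (x : Fin N → ℝ) : M.normSqCN x = ‖M.white x‖ ^ 2 := by
  simp [normSqCN, white, EuclideanSpace.norm_sq_eq, div_pow]

theorem white_add (M : Model H) {N : ℕ} (v w : Fin N → ℝ) :
    M.white (v + w) = M.white v + M.white w := by
  ext i; simp [white, add_div]

theorem white_sub (M : Model H) {N : ℕ} (v w : Fin N → ℝ) :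
    M.white (v - w) = M.white v - M.white w := by
  ext i; simp [white, sub_div]

theorem white_smul (M : Model H) {N : ℕ} (c : ℝ) (v : Fin N → ℝ) :
    M.white (c • v) = c • M.white v := by
  ext i; simp [white, mul_div_assoc]

theorem white_sqrtCN (M : Model H) {N : ℕ} (v : Fin N → ℝ) :
    M.white (M.sqrtCN v) = WithLp.toLp 2 v := by
  ext i; simp [white, sqrtCN, (M.lam_pos i).ne']

theorem white_CN_gradΨN (M : Model H) {N : ℕ} (x : Fin N → ℝ) :
    M.white (M.CN (M.gradΨN x)) = M.whiteGrad x := by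
  ext i
  have := (M.lam_pos i).ne'
  simp only [white, whiteGrad, CN_apply]
  field_simp

theorem white_drift (M : Model H) {N : ℕ} (x : Fin N → ℝ) :
    M.white (M.drift x) = M.white x + M.whiteGrad x := by
  rw [drift, white_add, white_CN_gradΨN]

theorem white_proposal (M : Model H) (ℓ : ℝ) {N : ℕ} (x ξ : Fin N → ℝ) :
    M.white (M.proposal ℓ x ξ) = M.white x - step ℓ N • (M.white x + M.whiteGrad x) +
      √(2 * step ℓ N) • WithLp.toLp 2 ξ := by
  rw [proposal, white_add, white_sub, white_smul, white_smul, white_drift, white_sqrtCN]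

theorem inner_white_whiteGrad (M : Model H) {N : ℕ} (v x : Fin N → ℝ) :
    ⟪M.white v, M.whiteGrad x⟫ = fderiv ℝ M.Ψ (M.embed x) (M.embed v) := by
  simp only [white, whiteGrad, EuclideanSpace.inner_toLp_toLp, dotProduct, embed, map_sum, map_smul,
    smul_eq_mul, Pi.star_apply, star_trivial, gradΨN]
  refine Finset.sum_congr rfl fun i _ => ?_
  have := (M.lam_pos i).ne'
  field_simp

/-! ### Consequences of the assumptions on `C` and `Ψ` -/

/-- One constant `A` which bounds everything the analysis uses of `C` and `Ψ`: the Hilbert-Schmidt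
norm of `C^{1/2} : H → H^s`, the derivative of `Ψ` and its Lipschitz constant. -/
structure Controlled (M : Model H) (A : ℝ) : Prop where
  one_le : 1 ≤ A
  trace : ∀ N : ℕ, ∑ i : Fin N, ((i : ℝ) + 1) ^ (2 * M.s) * M.lam i ^ 2 ≤ A ^ 2
  differentiable : Differentiable ℝ M.Ψ
  bounded : ∀ x, ‖fderiv ℝ M.Ψ x‖ ≤ A
  lipschitz : ∀ x y, ‖fderiv ℝ M.Ψ x - fderiv ℝ M.Ψ y‖ ≤ A * ‖x - y‖

/-- `C^{1/2}` is Hilbert-Schmidt into `H^s` because `∑ j^{2s - 2κ}` converges for `s < κ - 1/2`. -/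
theorem Assumption.exists_controlled {M : Model H} (hM : M.Assumption) :
    ∃ A, M.Controlled A := by
  obtain ⟨κ, -, -, hs, c₁, c₂, -, hlam⟩ := hM.decay
  obtain ⟨K₁, hK₁⟩ := hM.bounded
  obtain ⟨K₂, hK₂⟩ := hM.lipschitz
  have hle : ∀ j : ℕ, ((j : ℝ) + 1) ^ (2 * M.s) * M.lam j ^ 2 ≤
      c₂ ^ 2 * ((j + 1 : ℕ) : ℝ) ^ (2 * M.s - 2 * κ) := fun j => by
    have hj : (0 : ℝ) < (j : ℝ) + 1 := by positivity
    have h1 : M.lam j ^ 2 ≤ (c₂ * ((j : ℝ) + 1) ^ (-κ)) ^ 2 :=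
      pow_le_pow_left₀ (M.lam_pos j).le (hlam j).2 2
    calc _ ≤ ((j : ℝ) + 1) ^ (2 * M.s) * (c₂ * ((j : ℝ) + 1) ^ (-κ)) ^ 2 := by gcongr
      _ = c₂ ^ 2 * (((j : ℝ) + 1) ^ (2 * M.s) * ((j : ℝ) + 1) ^ (-(2 * κ))) := by
          rw [mul_pow, ← Real.rpow_mul_natCast hj.le]; ring_nf
      _ = _ := by rw [← Real.rpow_add hj]; push_cast; ring_nf
  have hsum : Summable fun j : ℕ => c₂ ^ 2 * ((j + 1 : ℕ) : ℝ) ^ (2 * M.s - 2 * κ) :=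
    ((summable_nat_add_iff 1).2 (Real.summable_nat_rpow.2 (by linarith))).mul_left _
  set B := ∑' j : ℕ, c₂ ^ 2 * ((j + 1 : ℕ) : ℝ) ^ (2 * M.s - 2 * κ)
  have hB : 0 ≤ B := tsum_nonneg fun j => by positivity
  refine ⟨1 + B + |K₁| + |K₂|, by linarith [abs_nonneg K₁, abs_nonneg K₂], fun N => ?_,
    hM.differentiable, fun x => ?_, fun x y => ?_⟩
  · have h1 : ∑ i : Fin N, ((i : ℝ) + 1) ^ (2 * M.s) * M.lam i ^ 2 ≤ B := by
      rw [← Finset.sum_range fun i => ((i : ℝ) + 1) ^ (2 * M.s) * M.lam i ^ 2]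
      exact (Finset.sum_le_sum fun i _ => hle i).trans
        (hsum.sum_le_tsum _ fun j _ => by positivity)
    nlinarith [abs_nonneg K₁, abs_nonneg K₂]
  · exact (hK₁ x).trans (by linarith [le_abs_self K₁, abs_nonneg K₂])
  · refine (hK₂ x y).trans (mul_le_mul_of_nonneg_right ?_ (norm_nonneg _))
    linarith [le_abs_self K₂, abs_nonneg K₁]

namespace Controlled

variable {M : Model H} {A : ℝ} (hA : M.Controlled A)
include hA

theorem weight_le (j : ℕ) : ((j : ℝ) + 1) ^ (2 * M.s) * M.lam j ^ 2 ≤ A ^ 2 := by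
  have h := hA.trace (j + 1)
  refine le_trans ?_ h
  exact Finset.single_le_sum (f := fun i : Fin (j + 1) =>
    ((i : ℝ) + 1) ^ (2 * M.s) * M.lam i ^ 2) (fun i _ => by positivity)
    (Finset.mem_univ (Fin.last j))

/-- The norm of `H^s` is controlled by that of the white coordinates. -/
theorem norm_embed_le {N : ℕ} (v : Fin N → ℝ) : ‖M.embed v‖ ≤ A * ‖M.white v‖ := by
  have hA0 : 0 ≤ A := zero_le_one.trans hA.one_le
  refine le_of_sq_le_sq ?_ (by positivity)
  rw [mul_pow, norm_sq_embed, ← normSqCN_eq, normSqCN, Finset.mul_sum]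
  refine Finset.sum_le_sum fun i _ => ?_
  have := (M.lam_pos i).ne'
  calc _ = (((i : ℝ) + 1) ^ (2 * M.s) * M.lam i ^ 2) * (v i ^ 2 / M.lam i ^ 2) := by field_simp
    _ ≤ _ := mul_le_mul_of_nonneg_right (hA.weight_le i) (by positivity)

/-- `C^{1/2}` maps the dual of `H^s` boundedly into `H`; the norm on the dual is tested on the
vector `C L`. -/
theorem norm_dual_le (N : ℕ) (L : Hs M.φ M.s →L[ℝ] ℝ) :
    ‖(WithLp.toLp 2 fun i : Fin N => M.lam i * L (Hs.basis M.φ M.s i) :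
      EuclideanSpace ℝ (Fin N))‖ ≤ A * ‖L‖ := by
  set p : EuclideanSpace ℝ (Fin N) := WithLp.toLp 2 fun i => M.lam i * L (Hs.basis M.φ M.s i)
  have h1 : ‖p‖ ^ 2 = L (M.embed (M.sqrtCN p.ofLp)) := by
    simp only [EuclideanSpace.norm_sq_eq, embed, map_sum, map_smul, sqrtCN, smul_eq_mul, p,
      Real.norm_eq_abs, sq_abs]
    exact Finset.sum_congr rfl fun i _ => by ring
  have h2 : ‖M.embed (M.sqrtCN p.ofLp)‖ ≤ A * ‖p‖ := by
    simpa [white_sqrtCN] using hA.norm_embed_le (M.sqrtCN p.ofLp)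
  have h3 : ‖p‖ ^ 2 ≤ ‖L‖ * (A * ‖p‖) :=
    h1.le.trans ((le_abs_self _).trans ((L.le_opNorm _).trans (by gcongr)))
  rcases (norm_nonneg p).eq_or_lt with h | h
  · rw [← h]
    have := hA.one_le
    positivity
  · nlinarith

theorem norm_whiteGrad_le {N : ℕ} (x : Fin N → ℝ) : ‖M.whiteGrad x‖ ≤ A ^ 2 := by
  refine (hA.norm_dual_le N (fderiv ℝ M.Ψ (M.embed x))).trans ?_
  have := hA.one_le
  nlinarith [hA.bounded (M.embed x)]

theorem norm_whiteGrad_sub_le {N : ℕ} (x y : Fin N → ℝ) :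
    ‖M.whiteGrad y - M.whiteGrad x‖ ≤ A ^ 2 * ‖M.embed y - M.embed x‖ := by
  have h := hA.norm_dual_le N (fderiv ℝ M.Ψ (M.embed y) - fderiv ℝ M.Ψ (M.embed x))
  have h1 := hA.lipschitz (M.embed y) (M.embed x)
  have h2 : M.whiteGrad y - M.whiteGrad x = WithLp.toLp 2 fun i : Fin N => M.lam i *
      (fderiv ℝ M.Ψ (M.embed y) - fderiv ℝ M.Ψ (M.embed x)) (Hs.basis M.φ M.s i) := by
    ext i; simp [whiteGrad, gradΨN, mul_sub]
  rw [h2]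
  have := hA.one_le
  nlinarith

theorem norm_embed_CN_gradΨN_le {N : ℕ} (x : Fin N → ℝ) :
    ‖M.embed (M.CN (M.gradΨN x))‖ ≤ A ^ 3 := by
  have h := hA.norm_embed_le (M.CN (M.gradΨN x))
  rw [white_CN_gradΨN] at h
  have := hA.one_le
  nlinarith [hA.norm_whiteGrad_le x]

theorem abs_Ψ_sub_le (u v : Hs M.φ M.s) : |M.Ψ u - M.Ψ v| ≤ A * ‖u - v‖ :=
  convex_univ.norm_image_sub_le_of_norm_fderiv_le (fun x _ => hA.differentiable x)
    (fun x _ => hA.bounded x) (Set.mem_univ v) (Set.mem_univ u)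

end Controlled
end Model
end MALA

namespace MALA

/-! ### The log-acceptance ratio -/

/-- The remainder of the log-acceptance ratio in terms of scalars: `Z`, `X`, `G`, `G'` stand for the
norms of the position, the noise and the two gradients, and `q`, `p₁`, …, `p₆` for inner products of
these vectors. -/
theorem abs_remainder_le {h r A Z X q n a G G' p₁ p₂ p₃ p₄ p₅ p₆ t : ℝ} (hh : 0 < h) (hh1 : h ≤ 1)
    (hr0 : 0 ≤ r) (hr2 : r ≤ 2 * h) (hA : 1 ≤ A) (ht : 0 ≤ t) (hZ : 0 ≤ Z) (hX : 0 ≤ X)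
    (hG0 : 0 ≤ G) (hG0' : 0 ≤ G') (hG : G ≤ A) (hG' : G' ≤ A) (ha : |a| ≤ A * (h * t))
    (h1 : |p₁| ≤ Z * A) (h2 : |p₂| ≤ X * A) (h3 : |p₃| ≤ X * A) (h4 : |p₄| ≤ Z * A)
    (h5 : |p₅| ≤ A * A) (h6 : |p₆| ≤ Z * (A * (h * t))) :
    |a - h ^ 6 / 4 * Z ^ 2 - h ^ 4 / 2 * (X ^ 2 - n) - h ^ 2 / 4 * ((h ^ 4 - 1) * G ^ 2
        + G' ^ 2 + 2 * (1 - h ^ 2) * r * q - 2 * h ^ 2 * (1 - h ^ 2) * p₁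
        - 2 * h ^ 2 * r * p₂ + 2 * (r * p₃ - h ^ 2 * p₄ - h ^ 2 * p₅) + 2 * p₆)| ≤
      10 * A ^ 2 * h * (1 + (h ^ 2) ^ 2 * (Z ^ 2 + X ^ 2 + q ^ 2 + (X ^ 2 - n) ^ 2) + t ^ 2) := by
  set M := 1 + (h ^ 2) ^ 2 * (Z ^ 2 + X ^ 2 + q ^ 2 + (X ^ 2 - n) ^ 2) + t ^ 2 with hM
  have hM' : M = 1 + (h ^ 2 * Z) ^ 2 + (h ^ 2 * X) ^ 2 + (h ^ 2 * |q|) ^ 2 +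
      (h ^ 2 * |X ^ 2 - n|) ^ 2 + t ^ 2 := by
    simp only [hM, mul_pow, sq_abs]; ring
  have s1 := sq_nonneg (h ^ 2 * Z)
  have s2 := sq_nonneg (h ^ 2 * X)
  have s3 := sq_nonneg (h ^ 2 * |q|)
  have s4 := sq_nonneg (h ^ 2 * |X ^ 2 - n|)
  have s5 := sq_nonneg t
  have sq_le {x : ℝ} (hx : x ^ 2 ≤ M - 1) : x ≤ M := by nlinarith [sq_nonneg (x - 1)]
  have hM1 : 1 ≤ M := by linarith
  have tM : t ≤ M := sq_le (by linarith)
  have uM : h ^ 2 * Z ≤ M := sq_le (by linarith)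
  have vM : h ^ 2 * X ≤ M := sq_le (by linarith)
  have pM : h ^ 2 * |q| ≤ M := sq_le (by linarith)
  have mM : h ^ 2 * |X ^ 2 - n| ≤ M := sq_le (by linarith)
  have utM : h ^ 2 * Z * t ≤ M := by linarith [sq_nonneg (h ^ 2 * Z - t)]
  have u2M : (h ^ 2 * Z) ^ 2 ≤ M := by linarith
  clear_value M
  clear hM hM' s1 s2 s3 s4 s5 sq_le
  have hM0 : 0 ≤ M := by linarith
  have hA0 : 0 ≤ A := by linarith
  have hA2 : A ≤ A ^ 2 := by nlinarith
  have hA1 : 1 ≤ A ^ 2 := by nlinarith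
  have hh2 : h ^ 2 ≤ h := by nlinarith
  have hd0 : 0 ≤ 1 - h ^ 2 := by linarith
  have hd1 : 1 - h ^ 2 ≤ 1 := by linarith [sq_nonneg h]
  -- every term is a product of a quantity of order `A ^ 2`, one of order `h` and one of order `M`
  have key {c x y m : ℝ} (hx : x ≤ A ^ 2) (hy0 : 0 ≤ y) (hy : y ≤ c * h)
      (hm0 : 0 ≤ m) (hm : m ≤ M) : x * y * m ≤ c * (A ^ 2 * h * M) := by
    have := hy0.trans hy
    calc x * y * m ≤ A ^ 2 * (c * h) * M := by gcongr
      _ = _ := by ring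
  have e1 : |a| ≤ 1 * (A ^ 2 * h * M) :=
    ha.trans (by linarith only [key hA2 hh.le (one_mul h).ge ht tM])
  have e2 : |h ^ 6 / 4 * Z ^ 2| ≤ 1 / 4 * (A ^ 2 * h * M) := by
    rw [abs_of_nonneg (by positivity)]
    exact le_of_eq_of_le (by ring)
      (key (c := 1 / 4) (y := h ^ 2 / 4) hA1 (by positivity) (by linarith only [hh2, hh, hr2]) (by positivity) u2M)
  have e3 : |h ^ 4 / 2 * (X ^ 2 - n)| ≤ 1 / 2 * (A ^ 2 * h * M) := by
    rw [abs_mul, abs_of_nonneg (by positivity : (0 : ℝ) ≤ h ^ 4 / 2)]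
    exact le_of_eq_of_le (by ring)
      (key (c := 1 / 2) (y := h ^ 2 / 2) hA1 (by positivity) (by linarith only [hh2, hh, hr2]) (by positivity) mM)
  have e4 : |h ^ 2 / 4 * ((h ^ 4 - 1) * G ^ 2)| ≤ 1 / 4 * (A ^ 2 * h * M) := by
    have h41 : h ^ 4 ≤ 1 := pow_le_one₀ hh.le hh1
    have h40 : 0 ≤ h ^ 4 := by positivity
    have : |h ^ 4 - 1| ≤ 1 := abs_le.2 ⟨by linarith, by linarith⟩
    rw [abs_mul, abs_mul, abs_of_nonneg (by positivity : (0 : ℝ) ≤ h ^ 2 / 4),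
      abs_of_nonneg (sq_nonneg G)]
    calc h ^ 2 / 4 * (|h ^ 4 - 1| * G ^ 2) ≤ h ^ 2 / 4 * (1 * A ^ 2) := by gcongr
      _ = A ^ 2 * (h ^ 2 / 4) * 1 := by ring
      _ ≤ _ := key le_rfl (by positivity) (by linarith only [hh2, hh, hr2]) zero_le_one hM1
  have e5 : |h ^ 2 / 4 * G' ^ 2| ≤ 1 / 4 * (A ^ 2 * h * M) := by
    rw [abs_of_nonneg (by positivity)]
    calc h ^ 2 / 4 * G' ^ 2 ≤ h ^ 2 / 4 * A ^ 2 := by gcongr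
      _ = A ^ 2 * (h ^ 2 / 4) * 1 := by ring
      _ ≤ _ := key le_rfl (by positivity) (by linarith only [hh2, hh, hr2]) zero_le_one hM1
  have e6 : |h ^ 2 / 4 * (2 * (1 - h ^ 2) * r * q)| ≤ 1 * (A ^ 2 * h * M) := by
    have : h ^ 2 / 4 * (2 * (1 - h ^ 2) * r * q) = (1 - h ^ 2) * (r / 2) * (h ^ 2 * q) := by ring
    rw [this, abs_mul, abs_mul, abs_mul, abs_of_nonneg hd0,
      abs_of_nonneg (by positivity : 0 ≤ r / 2), abs_of_nonneg (sq_nonneg h)]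
    exact key (hd1.trans hA1) (by positivity) (by linarith only [hh2, hh, hr2]) (by positivity) pM
  have e7 : |h ^ 2 / 4 * (2 * h ^ 2 * (1 - h ^ 2) * p₁)| ≤ 1 / 2 * (A ^ 2 * h * M) := by
    have : h ^ 2 / 4 * (2 * h ^ 2 * (1 - h ^ 2) * p₁) = (1 - h ^ 2) * (h ^ 4 / 2 * p₁) := by ring
    rw [this, abs_mul, abs_mul, abs_of_nonneg hd0,
      abs_of_nonneg (by positivity : (0 : ℝ) ≤ h ^ 4 / 2)]
    calc (1 - h ^ 2) * (h ^ 4 / 2 * |p₁|) ≤ 1 * (h ^ 4 / 2 * (Z * A)) := by gcongr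
      _ = A * (h ^ 2 / 2) * (h ^ 2 * Z) := by ring
      _ ≤ _ := key hA2 (by positivity) (by linarith only [hh2, hh, hr2]) (by positivity) uM
  have e8 : |h ^ 2 / 4 * (2 * h ^ 2 * r * p₂)| ≤ 1 * (A ^ 2 * h * M) := by
    rw [abs_mul, abs_mul, abs_of_nonneg (by positivity : (0 : ℝ) ≤ h ^ 2 / 4),
      abs_of_nonneg (by positivity : (0 : ℝ) ≤ 2 * h ^ 2 * r)]
    calc h ^ 2 / 4 * (2 * h ^ 2 * r * |p₂|) ≤ h ^ 2 / 4 * (2 * h ^ 2 * (2 * h) * (X * A)) := by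
          gcongr
      _ = A * (h ^ 2 * h) * (h ^ 2 * X) := by ring
      _ ≤ _ := key hA2 (by positivity) (by linarith only [mul_le_mul_of_nonneg_right (hh2.trans hh1) hh.le]) (by positivity) vM
  have e9 : |h ^ 2 / 2 * (r * p₃)| ≤ 1 * (A ^ 2 * h * M) := by
    rw [abs_mul, abs_mul, abs_of_nonneg (by positivity : (0 : ℝ) ≤ h ^ 2 / 2), abs_of_nonneg hr0]
    calc h ^ 2 / 2 * (r * |p₃|) ≤ h ^ 2 / 2 * (2 * h * (X * A)) := by gcongr
      _ = A * h * (h ^ 2 * X) := by ring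
      _ ≤ _ := key hA2 (by positivity) (by linarith only [hh2, hh, hr2]) (by positivity) vM
  have e10 : |h ^ 2 / 2 * (h ^ 2 * p₄)| ≤ 1 / 2 * (A ^ 2 * h * M) := by
    rw [abs_mul, abs_mul, abs_of_nonneg (by positivity : (0 : ℝ) ≤ h ^ 2 / 2),
      abs_of_nonneg (sq_nonneg h)]
    calc h ^ 2 / 2 * (h ^ 2 * |p₄|) ≤ h ^ 2 / 2 * (h ^ 2 * (Z * A)) := by gcongr
      _ = A * (h ^ 2 / 2) * (h ^ 2 * Z) := by ring
      _ ≤ _ := key hA2 (by positivity) (by linarith only [hh2, hh, hr2]) (by positivity) uM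
  have e11 : |h ^ 2 / 2 * (h ^ 2 * p₅)| ≤ 1 / 2 * (A ^ 2 * h * M) := by
    rw [abs_mul, abs_mul, abs_of_nonneg (by positivity : (0 : ℝ) ≤ h ^ 2 / 2),
      abs_of_nonneg (sq_nonneg h)]
    calc h ^ 2 / 2 * (h ^ 2 * |p₅|) ≤ h ^ 2 / 2 * (1 * (A * A)) := by gcongr; linarith only [hh2, hh1]
      _ = A ^ 2 * (h ^ 2 / 2) * 1 := by ring
      _ ≤ _ := key le_rfl (by positivity) (by linarith only [hh2, hh, hr2]) zero_le_one hM1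
  have e12 : |h ^ 2 / 2 * p₆| ≤ 1 / 2 * (A ^ 2 * h * M) := by
    rw [abs_mul, abs_of_nonneg (by positivity : (0 : ℝ) ≤ h ^ 2 / 2)]
    calc h ^ 2 / 2 * |p₆| ≤ h ^ 2 / 2 * (Z * (A * (h * t))) := by gcongr
      _ = A * (h / 2) * (h ^ 2 * Z * t) := by ring
      _ ≤ _ := key hA2 (by positivity) (by linarith only [hh2, hh, hr2]) (by positivity) utM
  have hB : 0 ≤ A ^ 2 * h * M := by positivity
  refine abs_le.2 ⟨?_, ?_⟩
  · linarith only [hB, (abs_le.1 e1).1, (abs_le.1 e2).2, (abs_le.1 e3).2, (abs_le.1 e4).2,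
      (abs_le.1 e5).2, (abs_le.1 e6).2, (abs_le.1 e7).1, (abs_le.1 e8).1, (abs_le.1 e9).2,
      (abs_le.1 e10).1, (abs_le.1 e11).1, (abs_le.1 e12).2]
  · linarith only [hB, (abs_le.1 e1).2, (abs_le.1 e2).1, (abs_le.1 e3).1, (abs_le.1 e4).1,
      (abs_le.1 e5).1, (abs_le.1 e6).1, (abs_le.1 e7).2, (abs_le.1 e8).2, (abs_le.1 e9).1,
      (abs_le.1 e10).2, (abs_le.1 e11).2, (abs_le.1 e12).1]

section InnerProduct

variable {E : Type*} [NormedAddCommGroup E] [InnerProductSpace ℝ E]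

/-- Expansion of the squared norm of a proposal `w`, with noise level `r = √(2δ)`. -/
theorem norm_sq_proposal {z g ξ w : E} {δ r : ℝ} (hr : r ^ 2 = 2 * δ)
    (hw : w = z - δ • (z + g) + r • ξ) :
    ‖w‖ ^ 2 = (1 - δ) ^ 2 * ‖z‖ ^ 2 + 2 * δ * ‖ξ‖ ^ 2 + δ ^ 2 * ‖g‖ ^ 2
      + 2 * (1 - δ) * r * ⟪z, ξ⟫ - 2 * δ * (1 - δ) * ⟪z, g⟫ - 2 * δ * r * ⟪g, ξ⟫ := by
  obtain rfl : δ = r ^ 2 / 2 := by linarith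
  simp only [hw, ← real_inner_self_eq_norm_sq, inner_add_left, inner_add_right, inner_sub_left,
    inner_sub_right, real_inner_smul_left, real_inner_smul_right, real_inner_comm z ξ,
    real_inner_comm z g, real_inner_comm g ξ]
  ring

/-- The logarithm of the ratio of proposal densities, combined with the Gaussian part of the ratio
of target densities: the two quadratic forms in `w - z` cancel. -/
theorem log_ratio_eq {z g g' w : E} {δ : ℝ} (hδ : δ ≠ 0) :
    -(1 / 2) * ‖w‖ ^ 2 + 1 / 2 * ‖z‖ ^ 2 - 1 / (4 * δ) * ‖z - w + δ • (w + g')‖ ^ 2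
        + 1 / (4 * δ) * ‖w - z + δ • (z + g)‖ ^ 2 =
      1 / 2 * (⟪w - z, g⟫ + ⟪w - z, g'⟫) - δ / 4 * (‖w + g'‖ ^ 2 - ‖z + g‖ ^ 2) := by
  simp only [← real_inner_self_eq_norm_sq, inner_add_left, inner_add_right, inner_sub_left,
    inner_sub_right, real_inner_smul_left, real_inner_smul_right, real_inner_comm w z,
    real_inner_comm z g, real_inner_comm w g, real_inner_comm z g', real_inner_comm w g']
  field_simp
  ring

/-- The main term of the log-acceptance ratio is `δ² (‖z‖² - n) / 2`; everything else is of order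
`√δ`, relative to quantities whose expectations stay bounded. -/
theorem abs_log_ratio_sub_le {z g g' ξ w : E} {δ n a A D : ℝ} (hδ : 0 < δ) (hδ1 : δ ≤ 1)
    (hw : w = z - δ • (z + g) + √(2 * δ) • ξ) (hA : 1 ≤ A) (hD : 0 ≤ D)
    (hg : ‖g‖ ≤ A) (hg' : ‖g'‖ ≤ A) (hgg : ‖g' - g‖ ≤ A * D) (ha : |a| ≤ A * D) :
    |a - δ / 4 * (‖w + g'‖ ^ 2 - ‖z + g‖ ^ 2) - δ ^ 2 / 2 * (‖z‖ ^ 2 - n)| ≤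
      10 * A ^ 2 * √δ * (1 + δ ^ 2 * (‖z‖ ^ 2 + ‖ξ‖ ^ 2 + ⟪z, ξ⟫ ^ 2 + (‖ξ‖ ^ 2 - n) ^ 2)
        + D ^ 2 / δ) := by
  obtain ⟨h, hh, rfl⟩ : ∃ h : ℝ, 0 < h ∧ δ = h ^ 2 :=
    ⟨√δ, Real.sqrt_pos.2 hδ, (Real.sq_sqrt hδ.le).symm⟩
  have hh1 : h ≤ 1 := by nlinarith
  obtain ⟨t, rfl⟩ : ∃ t, D = h * t := ⟨D / h, by field_simp⟩
  have ht : 0 ≤ t := by nlinarith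
  set r := √(2 * h ^ 2) with hrdef
  have hr : r ^ 2 = 2 * h ^ 2 := Real.sq_sqrt (by positivity)
  have hr0 : 0 ≤ r := Real.sqrt_nonneg _
  have hr2 : r ≤ 2 * h := by nlinarith
  rw [Real.sqrt_sq hh.le, mul_pow, mul_div_cancel_left₀ _ (by positivity)]
  have hE : a - h ^ 2 / 4 * (‖w + g'‖ ^ 2 - ‖z + g‖ ^ 2) - (h ^ 2) ^ 2 / 2 * (‖z‖ ^ 2 - n) =
      a - h ^ 6 / 4 * ‖z‖ ^ 2 - h ^ 4 / 2 * (‖ξ‖ ^ 2 - n) - h ^ 2 / 4 * ((h ^ 4 - 1) * ‖g‖ ^ 2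
        + ‖g'‖ ^ 2 + 2 * (1 - h ^ 2) * r * ⟪z, ξ⟫ - 2 * h ^ 2 * (1 - h ^ 2) * ⟪z, g⟫
        - 2 * h ^ 2 * r * ⟪g, ξ⟫ + 2 * (r * ⟪ξ, g'⟫ - h ^ 2 * ⟪z, g'⟫ - h ^ 2 * ⟪g, g'⟫)
        + 2 * ⟪z, g' - g⟫) := by
    have h1 : ⟪w, g'⟫ = ⟪z, g'⟫ - h ^ 2 * (⟪z, g'⟫ + ⟪g, g'⟫) + r * ⟪ξ, g'⟫ := by
      rw [hw]
      simp only [inner_add_left, inner_sub_left, real_inner_smul_left]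
    rw [norm_add_sq_real, norm_add_sq_real, norm_sq_proposal hr hw, h1, inner_sub_right]
    ring
  rw [hE]
  have cs (u v : E) {B : ℝ} (hv : ‖v‖ ≤ B) : |⟪u, v⟫| ≤ ‖u‖ * B :=
    (abs_real_inner_le_norm u v).trans (by gcongr)
  have h1 := cs z g hg
  have h2 : |⟪g, ξ⟫| ≤ ‖ξ‖ * A := by rw [real_inner_comm]; exact cs ξ g hg
  have h3 := cs ξ g' hg'
  have h4 := cs z g' hg'
  have h5 : |⟪g, g'⟫| ≤ A * A := (cs g g' hg').trans (by gcongr)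
  have h6 := cs z (g' - g) hgg
  have n1 := norm_nonneg z
  have n2 := norm_nonneg ξ
  have n3 := norm_nonneg g
  have n4 := norm_nonneg g'
  generalize ⟪z, g⟫ = p1 at *
  generalize ⟪g, ξ⟫ = p2 at *
  generalize ⟪ξ, g'⟫ = p3 at *
  generalize ⟪z, g'⟫ = p4 at *
  generalize ⟪g, g'⟫ = p5 at *
  generalize ⟪z, g' - g⟫ = p6 at *
  generalize ⟪z, ξ⟫ = q at *
  generalize ‖z‖ = Z at *
  generalize ‖ξ‖ = X at *
  clear hE cs hgg hw
  generalize ‖g‖ = G at *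
  generalize ‖g'‖ = G' at *
  exact abs_remainder_le hh hh1 hr0 hr2 hA ht n1 n2 n3 n4 hg hg' ha h1 h2 h3 h4 h5 h6

end InnerProduct
end MALA

namespace MALA

/-- The function `t ↦ 1 ∧ e^t` is `1`-Lipschitz. -/
theorem abs_min_one_exp_sub_le (a b : ℝ) :
    |min 1 (Real.exp a) - min 1 (Real.exp b)| ≤ |a - b| := by
  have hmin (c : ℝ) : min 1 (Real.exp c) = Real.exp (min 0 c) := by
    rw [Real.exp_monotone.map_min, Real.exp_zero]
  have key {u v : ℝ} (hu : u ≤ 0) (hvu : v ≤ u) : |Real.exp u - Real.exp v| ≤ |u - v| := by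
    rw [abs_of_nonneg (sub_nonneg.2 (Real.exp_le_exp.2 hvu)), abs_of_nonneg (sub_nonneg.2 hvu)]
    have h1 : Real.exp v = Real.exp u * Real.exp (v - u) := by rw [← Real.exp_add]; ring_nf
    have h2 := Real.add_one_le_exp (v - u)
    have h3 := Real.exp_le_one_iff.2 hu
    have h4 := Real.exp_pos u
    nlinarith
  rw [hmin, hmin]
  have h : |min 0 a - min 0 b| ≤ |a - b| := by
    simpa using abs_min_sub_min_le_max 0 a 0 b
  refine le_trans ?_ h
  rcases le_total (min 0 b) (min 0 a) with hab | hab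
  · exact key (min_le_left _ _) hab
  · rw [abs_sub_comm, abs_sub_comm (min 0 a)]
    exact key (min_le_left _ _) hab

namespace Model

variable {H : Type*} [NormedAddCommGroup H] [InnerProductSpace ℝ H]

theorem step_sq (ℓ : ℝ) {N : ℕ} (hN : N ≠ 0) : step ℓ N ^ 2 * N = ℓ ^ 2 := by
  have : (N : ℝ) ≠ 0 := by exact_mod_cast hN
  rw [step, div_pow, Real.sq_sqrt (by positivity), div_mul_cancel₀ _ this]

theorem accept_eq (M : Model H) {ℓ : ℝ} {N : ℕ} (hδ : step ℓ N ≠ 0) (x y : Fin N → ℝ) :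
    M.accept ℓ x y = min 1 (Real.exp (M.ΨN x - M.ΨN y
      + 1 / 2 * (⟪M.white y - M.white x, M.whiteGrad x⟫ +
        ⟪M.white y - M.white x, M.whiteGrad y⟫)
      - step ℓ N / 4 * (‖M.white y + M.whiteGrad y‖ ^ 2
        - ‖M.white x + M.whiteGrad x‖ ^ 2))) := by
  rw [add_sub_assoc, ← log_ratio_eq hδ]
  simp only [accept, targetDensity, proposalDensity, ← Real.exp_add, ← Real.exp_sub, normSqCN_eq,
    white_add, white_sub, white_smul, white_drift]
  ring_nf

/-! ### The energy of the chain -/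

/-- The quantity which controls the error of the approximation of the acceptance probability at `x`
and whose expectation grows at most by a factor `1 + O(δ)` per step. -/
noncomputable def energy (M : Model H) (δ : ℝ) {N : ℕ} (x : Fin N → ℝ) : ℝ :=
  1 + δ ^ 2 * ‖M.white x‖ ^ 2 + δ * ‖M.embed x‖ ^ 2

/-- The contribution of the noise `ξ` to the error and to the growth of the energy. -/
noncomputable def noiseEnergy (M : Model H) (δ : ℝ) {N : ℕ} (x ξ : Fin N → ℝ) : ℝ :=
  δ ^ 2 * (‖(WithLp.toLp 2 ξ : EuclideanSpace ℝ (Fin N))‖ ^ 2 + ⟪M.white x, WithLp.toLp 2 ξ⟫ ^ 2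
    + (‖(WithLp.toLp 2 ξ : EuclideanSpace ℝ (Fin N))‖ ^ 2 - N) ^ 2)
    + ‖M.embed (M.sqrtCN ξ)‖ ^ 2

theorem one_le_energy (M : Model H) {δ : ℝ} (hδ : 0 ≤ δ) {N : ℕ} (x : Fin N → ℝ) :
    1 ≤ M.energy δ x := by
  have : 0 ≤ δ ^ 2 * ‖M.white x‖ ^ 2 + δ * ‖M.embed x‖ ^ 2 := by positivity
  rw [energy]; linarith

theorem noiseEnergy_nonneg (M : Model H) (δ : ℝ) {N : ℕ} (x ξ : Fin N → ℝ) :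
    0 ≤ M.noiseEnergy δ x ξ := by
  rw [noiseEnergy]; positivity

namespace Controlled

variable {M : Model H} {A : ℝ} (hA : M.Controlled A)
include hA

/-- The error at `x` is at most of order `√δ` times the energy and the noise energy. -/
theorem abs_accept_sub_le {ℓ : ℝ} {N : ℕ} (hN : N ≠ 0) (hδ : 0 < step ℓ N) (hδ1 : step ℓ N ≤ 1)
    (x ξ : Fin N → ℝ) :
    |M.accept ℓ x (M.proposal ℓ x ξ) - limitAccept ℓ (M.S x)| ≤
      240 * A ^ 10 * √(step ℓ N) * (M.energy (step ℓ N) x + M.noiseEnergy (step ℓ N) x ξ) := by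
  have hA1 := hA.one_le
  have hlim : ℓ ^ 2 * (M.S x - 1) / 2 = step ℓ N ^ 2 / 2 * (‖M.white x‖ ^ 2 - N) := by
    have hN' : (N : ℝ) ≠ 0 := by exact_mod_cast hN
    rw [← step_sq ℓ hN, S, ← normSqCN_eq, normSqCN]
    field_simp
  rw [M.accept_eq hδ.ne', limitAccept, hlim]
  refine (abs_min_one_exp_sub_le _ _).trans ?_
  set y := M.proposal ℓ x ξ with hy
  set D := ‖M.embed y - M.embed x‖ with hD
  have hD0 : 0 ≤ D := norm_nonneg _
  have hA2 : 1 ≤ A ^ 2 := one_le_pow₀ hA1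
  have hAA : A ≤ A ^ 2 := by nlinarith
  have hder (u : Fin N → ℝ) : |⟪M.white y - M.white x, M.whiteGrad u⟫| ≤ A * D := by
    rw [← white_sub, inner_white_whiteGrad, embed_sub]
    exact (ContinuousLinearMap.le_opNorm _ _).trans
      (mul_le_mul_of_nonneg_right (hA.bounded _) (norm_nonneg _))
  have ha : |M.ΨN x - M.ΨN y + 1 / 2 * (⟪M.white y - M.white x, M.whiteGrad x⟫ +
      ⟪M.white y - M.white x, M.whiteGrad y⟫)| ≤ 2 * A ^ 2 * D := by
    have h1 : |M.ΨN x - M.ΨN y| ≤ A * D := by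
      rw [abs_sub_comm]; exact hA.abs_Ψ_sub_le _ _
    have h2 := abs_le.1 (hder x)
    have h3 := abs_le.1 (hder y)
    have h4 := abs_le.1 h1
    have h5 : A * D ≤ A ^ 2 * D := by gcongr
    exact abs_le.2 ⟨by linarith [h2.1, h3.1, h4.1], by linarith [h2.2, h3.2, h4.2]⟩
  have hgg : ‖M.whiteGrad y - M.whiteGrad x‖ ≤ 2 * A ^ 2 * D := by
    refine (hA.norm_whiteGrad_sub_le x y).trans ?_
    have : 0 ≤ A ^ 2 * D := by positivity
    linarith
  have hG (u : Fin N → ℝ) : ‖M.whiteGrad u‖ ≤ 2 * A ^ 2 := (hA.norm_whiteGrad_le u).trans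
    (by linarith)
  refine (abs_log_ratio_sub_le hδ hδ1 (M.white_proposal ℓ x ξ) (by linarith) hD0 (hG x) (hG y) hgg
    ha (n := N)).trans ?_
  set δ := step ℓ N
  have hDle : D ^ 2 / δ ≤ 3 * (δ * ‖M.embed x‖ ^ 2) + 3 * A ^ 6
      + 6 * ‖M.embed (M.sqrtCN ξ)‖ ^ 2 := by
    have h1 : M.embed y - M.embed x = √(2 * δ) • M.embed (M.sqrtCN ξ) -
        δ • (M.embed x + M.embed (M.CN (M.gradΨN x))) := by
      rw [hy, proposal, drift, embed_add, embed_sub, embed_smul, embed_smul, embed_add]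
      abel
    have h2 : D ≤ √(2 * δ) * ‖M.embed (M.sqrtCN ξ)‖ + (δ * ‖M.embed x‖ + δ * A ^ 3) := by
      rw [hD, h1]
      refine (norm_sub_le _ _).trans ?_
      rw [norm_smul, norm_smul, Real.norm_of_nonneg (Real.sqrt_nonneg _),
        Real.norm_of_nonneg hδ.le, ← mul_add]
      gcongr
      exact (norm_add_le _ _).trans (by linarith [hA.norm_embed_CN_gradΨN_le x])
    have hr : √(2 * δ) ^ 2 = 2 * δ := Real.sq_sqrt (by positivity)
    set r := √(2 * δ)
    set W := ‖M.embed (M.sqrtCN ξ)‖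
    set n := ‖M.embed x‖
    rw [div_le_iff₀ hδ]
    calc D ^ 2 ≤ (r * W + (δ * n + δ * A ^ 3)) ^ 2 := by gcongr
      _ ≤ 3 * ((r * W) ^ 2 + (δ * n) ^ 2 + (δ * A ^ 3) ^ 2) := by
          linarith [sq_nonneg (r * W - δ * n), sq_nonneg (r * W - δ * A ^ 3),
            sq_nonneg (δ * n - δ * A ^ 3)]
      _ = 3 * (2 * δ * W ^ 2 + δ * δ * n ^ 2 + δ * δ * A ^ 6) := by rw [mul_pow, hr]; ring
      _ ≤ 3 * (2 * δ * W ^ 2 + δ * δ * n ^ 2 + 1 * δ * A ^ 6) := by gcongr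
      _ = _ := by ring
  have hA6 : 1 ≤ A ^ 6 := one_le_pow₀ hA1
  have hfin : 1 + δ ^ 2 * (‖M.white x‖ ^ 2 + ‖(WithLp.toLp 2 ξ : EuclideanSpace ℝ (Fin N))‖ ^ 2
      + ⟪M.white x, WithLp.toLp 2 ξ⟫ ^ 2
      + (‖(WithLp.toLp 2 ξ : EuclideanSpace ℝ (Fin N))‖ ^ 2 - N) ^ 2) + D ^ 2 / δ ≤
      6 * A ^ 6 * (M.energy δ x + M.noiseEnergy δ x ξ) := by
    set p := δ ^ 2 * (‖(WithLp.toLp 2 ξ : EuclideanSpace ℝ (Fin N))‖ ^ 2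
      + ⟪M.white x, WithLp.toLp 2 ξ⟫ ^ 2
      + (‖(WithLp.toLp 2 ξ : EuclideanSpace ℝ (Fin N))‖ ^ 2 - N) ^ 2) with hp
    have hp0 : 0 ≤ p := by positivity
    rw [energy, noiseEnergy, ← hp]
    have q1 : 0 ≤ δ ^ 2 * ‖M.white x‖ ^ 2 := by positivity
    have q2 : 0 ≤ δ * ‖M.embed x‖ ^ 2 := by positivity
    have q3 : 0 ≤ ‖M.embed (M.sqrtCN ξ)‖ ^ 2 := by positivity
    have := mul_le_mul_of_nonneg_right hA6 (by positivity : 0 ≤ δ ^ 2 * ‖M.white x‖ ^ 2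
      + δ * ‖M.embed x‖ ^ 2 + p + ‖M.embed (M.sqrtCN ξ)‖ ^ 2)
    linarith
  refine (mul_le_mul_of_nonneg_left hfin (by positivity)).trans (le_of_eq ?_)
  ring

/-- The increase of the energy. The terms of order `√δ`, linear in the noise, are absorbed by
Young's inequality: in the `H^s` part this costs `O(1)` before the weight `δ`. -/
theorem energy_proposal_le {ℓ : ℝ} {N : ℕ} (hδ : 0 < step ℓ N) (hδ1 : step ℓ N ≤ 1)
    (x ξ : Fin N → ℝ) :
    M.energy (step ℓ N) (M.proposal ℓ x ξ) ≤ M.energy (step ℓ N) x +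
      16 * A ^ 6 * step ℓ N * (M.energy (step ℓ N) x + M.noiseEnergy (step ℓ N) x ξ) := by
  have hA1 := hA.one_le
  have hA6 : 1 ≤ A ^ 6 := one_le_pow₀ hA1
  have hA46 : A ^ 4 ≤ A ^ 6 := pow_le_pow_right₀ hA1 (by norm_num)
  have hw := M.white_proposal ℓ x ξ
  set y := M.proposal ℓ x ξ with hy
  set δ := step ℓ N
  have hr : √(2 * δ) ^ 2 = 2 * δ := Real.sq_sqrt (by positivity)
  have hn : ‖M.embed y‖ ≤ ‖M.embed x‖ + (δ * A ^ 3 + √(2 * δ) * ‖M.embed (M.sqrtCN ξ)‖) := by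
    have h1 : M.embed y = (1 - δ) • M.embed x - δ • M.embed (M.CN (M.gradΨN x)) +
        √(2 * δ) • M.embed (M.sqrtCN ξ) := by
      rw [hy, proposal, drift, embed_add, embed_sub, embed_smul, embed_smul, embed_add]
      module
    rw [h1]
    refine (norm_add_le _ _).trans ?_
    rw [← add_assoc, norm_smul √(2 * δ), Real.norm_of_nonneg (Real.sqrt_nonneg _)]
    gcongr
    refine (norm_sub_le _ _).trans ?_
    rw [norm_smul, norm_smul, Real.norm_of_nonneg hδ.le, Real.norm_of_nonneg (by linarith)]
    gcongr
    · exact mul_le_of_le_one_left (norm_nonneg _) (by linarith)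
    · exact hA.norm_embed_CN_gradΨN_le x
  have hz := norm_sq_proposal hr hw
  have hpos : 0 ≤ (‖(WithLp.toLp 2 ξ : EuclideanSpace ℝ (Fin N))‖ ^ 2 - N) ^ 2 := sq_nonneg _
  have hg := hA.norm_whiteGrad_le x
  have h1 := abs_le.1 (abs_real_inner_le_norm (M.white x) (M.whiteGrad x))
  have h2 := abs_le.1 (abs_real_inner_le_norm (M.whiteGrad x) (WithLp.toLp 2 ξ))
  have hG2 : ‖M.whiteGrad x‖ ^ 2 ≤ A ^ 4 := by
    calc _ ≤ (A ^ 2) ^ 2 := by gcongr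
      _ = _ := by ring
  rw [energy, energy, noiseEnergy]
  generalize (‖(WithLp.toLp 2 ξ : EuclideanSpace ℝ (Fin N))‖ ^ 2 - N) ^ 2 = s at *
  generalize ‖(WithLp.toLp 2 ξ : EuclideanSpace ℝ (Fin N))‖ = X at *
  generalize ‖M.embed (M.sqrtCN ξ)‖ = W at *
  generalize ⟪M.white x, M.whiteGrad x⟫ = p₁ at *
  generalize ⟪M.whiteGrad x, WithLp.toLp 2 ξ⟫ = p₂ at *
  generalize ⟪M.white x, WithLp.toLp 2 ξ⟫ = q at *
  have hr0 := Real.sqrt_nonneg (2 * δ)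
  generalize √(2 * δ) = r at *
  have n0 := norm_nonneg (M.embed y)
  have n1 := norm_nonneg (M.embed x)
  generalize ‖M.embed y‖ = m at *
  generalize ‖M.embed x‖ = n at *
  generalize ‖M.white y‖ = w at *
  generalize ‖M.white x‖ = Z at *
  generalize ‖M.whiteGrad x‖ = G at *
  clear_value δ
  have hd : 0 ≤ 1 - δ := by linarith
  have hδ2 : δ ^ 2 ≤ δ := by nlinarith
  have b1 : δ * m ^ 2 ≤ δ * n ^ 2 + δ * (δ * n ^ 2 + 4 * A ^ 6 + 8 * W ^ 2) := by
    set T := δ * A ^ 3 + r * W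
    have hT : T ^ 2 ≤ 2 * δ ^ 2 * A ^ 6 + 4 * δ * W ^ 2 := by
      have : T ^ 2 ≤ 2 * ((δ * A ^ 3) ^ 2 + (r * W) ^ 2) := by
        linarith [sq_nonneg (δ * A ^ 3 - r * W)]
      rw [mul_pow r, hr] at this
      linarith
    have hT' : T ^ 2 ≤ δ * (2 * A ^ 6 + 4 * W ^ 2) := by
      have := mul_le_mul_of_nonneg_right hδ2 (by positivity : 0 ≤ A ^ 6)
      linarith
    calc δ * m ^ 2 ≤ δ * (n + T) ^ 2 := by gcongr
      _ ≤ δ * n ^ 2 + δ * (δ * n ^ 2) + (1 + δ) * T ^ 2 := by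
          linarith [sq_nonneg (δ * n - T)]
      _ ≤ δ * n ^ 2 + δ * (δ * n ^ 2) + (1 + 1) * (δ * (2 * A ^ 6 + 4 * W ^ 2)) := by
          gcongr
      _ = _ := by ring
  have b2 : w ^ 2 ≤ Z ^ 2 + 4 * δ * X ^ 2 + δ * Z ^ 2 + 3 * A ^ 4 + 2 * (1 - δ) * r * q := by
    have c1 : (1 - δ) ^ 2 * Z ^ 2 ≤ 1 * Z ^ 2 := by gcongr; nlinarith
    have c2 : δ ^ 2 * G ^ 2 ≤ 1 * A ^ 4 := by gcongr; nlinarith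
    have c3 : -(2 * p₁) ≤ Z ^ 2 + A ^ 4 := by linarith [sq_nonneg (Z - G)]
    have c4 : -(2 * r * p₂) ≤ A ^ 4 + 2 * δ * X ^ 2 := by
      have := mul_le_mul_of_nonneg_left h2.1 hr0
      rw [← hr]
      linarith [sq_nonneg (G - r * X)]
    have c5 : δ * (1 - δ) * -(2 * p₁) ≤ δ * 1 * (Z ^ 2 + A ^ 4) := by
      calc _ ≤ δ * (1 - δ) * (Z ^ 2 + A ^ 4) := by gcongr
        _ ≤ _ := by gcongr; linarith
    have c6 := mul_le_mul_of_nonneg_left c4 hδ.le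
    have c7 := mul_le_mul_of_nonneg_right hδ2 (sq_nonneg X)
    have c8 := mul_le_mul_of_nonneg_right hδ1 (by positivity : 0 ≤ A ^ 4)
    rw [hz]
    linarith
  have b3 : δ ^ 2 * (2 * (1 - δ) * r * q) ≤ δ * (2 + δ ^ 2 * q ^ 2) := by
    calc δ ^ 2 * (2 * (1 - δ) * r * q) = δ * (2 * r * ((1 - δ) * (δ * q))) := by ring
      _ ≤ δ * (r ^ 2 + (1 - δ) ^ 2 * (δ * q) ^ 2) := by
          gcongr
          linarith [sq_nonneg (r - (1 - δ) * (δ * q))]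
      _ ≤ δ * (2 * 1 + 1 ^ 2 * (δ * q) ^ 2) := by
          rw [hr]
          gcongr
          linarith
      _ = _ := by ring
  have b4 : δ ^ 2 * w ^ 2 ≤
      δ ^ 2 * Z ^ 2 + δ * (4 * (δ ^ 2 * X ^ 2) + δ ^ 2 * Z ^ 2 + 3 * A ^ 6 + 2 + δ ^ 2 * q ^ 2) := by
    have d1 := mul_le_mul_of_nonneg_left b2 (sq_nonneg δ)
    have d2 : δ ^ 2 * A ^ 4 ≤ δ * A ^ 6 := by gcongr
    linarith
  have b5 := mul_le_mul_of_nonneg_right hA6 (by positivity : 0 ≤ δ * (δ ^ 2 * Z ^ 2 + δ * n ^ 2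
    + δ ^ 2 * (X ^ 2 + q ^ 2 + s) + W ^ 2))
  have b6 : 0 ≤ δ * (15 * (δ ^ 2 * Z ^ 2) + 15 * (δ * n ^ 2) + δ ^ 2 * (12 * X ^ 2 + 15 * q ^ 2
    + 16 * s) + 8 * W ^ 2) := by positivity
  have b7 := mul_le_mul_of_nonneg_left hA6 hδ.le
  linarith

end Controlled
end Model
end MALA

namespace MALA

/-! ### Measurability -/

namespace Model

variable {H : Type*} [NormedAddCommGroup H] [InnerProductSpace ℝ H]

theorem continuous_embed (M : Model H) (N : ℕ) :
    Continuous (M.embed : (Fin N → ℝ) → Hs M.φ M.s) := by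
  unfold embed
  exact continuous_finsetSum _ fun i _ => (continuous_apply i).smul continuous_const

theorem continuous_white (M : Model H) (N : ℕ) :
    Continuous (M.white : (Fin N → ℝ) → EuclideanSpace ℝ (Fin N)) := by
  unfold white
  fun_prop

theorem measurable_normSqCN (M : Model H) (N : ℕ) :
    Measurable (M.normSqCN : (Fin N → ℝ) → ℝ) := by
  unfold normSqCN
  fun_prop

theorem measurable_S (M : Model H) (N : ℕ) : Measurable (M.S : (Fin N → ℝ) → ℝ) := by
  unfold S
  fun_prop

theorem measurable_energy (M : Model H) (δ : ℝ) (N : ℕ) :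
    Measurable (M.energy δ : (Fin N → ℝ) → ℝ) := by
  have h1 := M.continuous_embed N
  have h2 := M.continuous_white N
  unfold energy
  exact Continuous.measurable (by fun_prop)

theorem chain_succ (M : Model H) (ℓ : ℝ) (x₀ : Hs M.φ M.s) {N : ℕ} {Ω : Type*}
    (ξ : ℕ → Fin N → Ω → ℝ) (U : ℕ → Ω → ℝ) (k : ℕ) :
    M.chain ℓ x₀ ξ U (k + 1) = fun ω =>
      if U k ω ≤ M.accept ℓ (M.chain ℓ x₀ ξ U k ω)
          (M.proposal ℓ (M.chain ℓ x₀ ξ U k ω) fun i => ξ k i ω)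
        then M.proposal ℓ (M.chain ℓ x₀ ξ U k ω) fun i => ξ k i ω
        else M.chain ℓ x₀ ξ U k ω := rfl

namespace Controlled

variable {M : Model H} {A : ℝ} (hA : M.Controlled A)
include hA

theorem measurable_ΨN (N : ℕ) : Measurable (M.ΨN : (Fin N → ℝ) → ℝ) :=
  (hA.differentiable.continuous.comp (M.continuous_embed N)).measurable

theorem continuous_fderiv : Continuous (fderiv ℝ M.Ψ) :=
  (LipschitzWith.of_dist_le_mul (K := ⟨A, zero_le_one.trans hA.one_le⟩) fun x y => by
    rw [dist_eq_norm, dist_eq_norm]; exact hA.lipschitz x y).continuous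

theorem measurable_drift (N : ℕ) : Measurable (M.drift : (Fin N → ℝ) → Fin N → ℝ) := by
  refine measurable_pi_lambda _ fun i => ?_
  simp only [drift, Pi.add_apply, CN_apply, gradΨN]
  exact (measurable_pi_apply i).add ((((hA.continuous_fderiv.comp
    (M.continuous_embed N)).clm_apply continuous_const).measurable).const_mul _)

theorem measurable_proposal (ℓ : ℝ) (N : ℕ) :
    Measurable fun p : (Fin N → ℝ) × (Fin N → ℝ) => M.proposal ℓ p.1 p.2 := by
  have h := hA.measurable_drift N
  have h1 : Measurable fun p : (Fin N → ℝ) × (Fin N → ℝ) => M.drift p.1 := h.comp measurable_fst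
  refine measurable_pi_lambda _ fun i => ?_
  have h2 := (measurable_pi_apply i).comp h1
  simp only [Function.comp_def] at h2
  simp only [proposal, sqrtCN, Pi.add_apply, Pi.sub_apply, Pi.smul_apply, smul_eq_mul]
  fun_prop

theorem measurable_targetDensity (N : ℕ) :
    Measurable (M.targetDensity : (Fin N → ℝ) → ℝ) :=
  (((M.measurable_normSqCN N).const_mul (-(1 / 2))).sub (hA.measurable_ΨN N)).exp

theorem measurable_proposalDensity (ℓ : ℝ) (N : ℕ) :
    Measurable fun p : (Fin N → ℝ) × (Fin N → ℝ) => M.proposalDensity ℓ p.1 p.2 := by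
  have h1 : Measurable fun p : (Fin N → ℝ) × (Fin N → ℝ) => M.drift p.1 :=
    (hA.measurable_drift N).comp measurable_fst
  have h2 : Measurable fun p : (Fin N → ℝ) × (Fin N → ℝ) => p.2 - p.1 + step ℓ N • M.drift p.1 :=
    (measurable_snd.sub measurable_fst).add (h1.fun_const_smul (step ℓ N))
  exact (((M.measurable_normSqCN N).comp h2).const_mul (-(1 / (4 * step ℓ N)))).exp

theorem measurable_accept (ℓ : ℝ) (N : ℕ) :
    Measurable fun p : (Fin N → ℝ) × (Fin N → ℝ) => M.accept ℓ p.1 p.2 := by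
  have h1 : Measurable fun p : (Fin N → ℝ) × (Fin N → ℝ) => M.targetDensity p.1 :=
    (hA.measurable_targetDensity N).comp measurable_fst
  have h2 : Measurable fun p : (Fin N → ℝ) × (Fin N → ℝ) => M.targetDensity p.2 :=
    (hA.measurable_targetDensity N).comp measurable_snd
  have h3 := hA.measurable_proposalDensity ℓ N
  have h4 : Measurable fun p : (Fin N → ℝ) × (Fin N → ℝ) => M.proposalDensity ℓ p.2 p.1 := by
    fun_prop
  exact measurable_const.min ((h2.mul h4).div (h1.mul h3))

/-- The chain at time `k` is measurable with respect to any `σ`-algebra for which the noise before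
time `k` is. -/
theorem measurable_chain (ℓ : ℝ) (x₀ : Hs M.φ M.s) {N : ℕ} {Ω : Type*} [MeasurableSpace Ω]
    {ξ : ℕ → Fin N → Ω → ℝ} {U : ℕ → Ω → ℝ} (k : ℕ) (hξ : ∀ j < k, ∀ i, Measurable (ξ j i))
    (hU : ∀ j < k, Measurable (U j)) : Measurable (M.chain ℓ x₀ ξ U k) := by
  induction k with
  | zero => exact measurable_const
  | succ k ih =>
    have hx := ih (fun j hj => hξ j (by omega)) (fun j hj => hU j (by omega))
    have hk : Measurable fun ω i => ξ k i ω := measurable_pi_lambda _ (hξ k (by omega))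
    have hy : Measurable fun ω => M.proposal ℓ (M.chain ℓ x₀ ξ U k ω) fun i => ξ k i ω :=
      (hA.measurable_proposal ℓ N).comp (hx.prodMk hk)
    have ha : Measurable fun ω => M.accept ℓ (M.chain ℓ x₀ ξ U k ω)
        (M.proposal ℓ (M.chain ℓ x₀ ξ U k ω) fun i => ξ k i ω) := by
      have := (hA.measurable_accept ℓ N).comp (hx.prodMk hy)
      exact this
    have hs := measurableSet_le (hU k (by omega)) ha
    simp only [chain_succ]
    exact Measurable.ite hs hy hx

theorem measurable_chainProposal (ℓ : ℝ) (x₀ : Hs M.φ M.s) {N : ℕ} {Ω : Type*} [MeasurableSpace Ω]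
    {ξ : ℕ → Fin N → Ω → ℝ} {U : ℕ → Ω → ℝ} (hξ : ∀ j i, Measurable (ξ j i))
    (hU : ∀ j, Measurable (U j)) (k : ℕ) : Measurable (M.chainProposal ℓ x₀ ξ U k) :=
  (hA.measurable_proposal ℓ N).comp
    ((hA.measurable_chain ℓ x₀ k (fun j _ => hξ j) fun j _ => hU j).prodMk
      (measurable_pi_lambda _ (hξ k)))

/-- The chain at time `k` is independent of the Gaussian noise of step `k`. -/
theorem indepFun_chain (ℓ : ℝ) (x₀ : Hs M.φ M.s) {N : ℕ} {Ω : Type*} [MeasurableSpace Ω]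
    {P : Measure Ω} {ξ : ℕ → Fin N → Ω → ℝ} {U : ℕ → Ω → ℝ} (hξ : ∀ j i, Measurable (ξ j i))
    (hU : ∀ j, Measurable (U j))
    (h : iIndepFun (Sum.elim (fun p : ℕ × Fin N => ξ p.1 p.2) U) P) (k : ℕ) :
    IndepFun (M.chain ℓ x₀ ξ U k) (fun ω i => ξ k i ω) P := by
  -- `past` and `pres` are the indices of the noise before time `k` and at time `k`
  let past : Set ((ℕ × Fin N) ⊕ ℕ) := {a | Sum.elim (fun p => p.1 < k) (· < k) a}
  let pres : Set ((ℕ × Fin N) ⊕ ℕ) := {a | Sum.elim (fun p => p.1 = k) (fun _ => False) a}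
  have hd : Disjoint past pres := by
    rw [Set.disjoint_left]
    rintro (p | j) h1 h2
    · exact absurd (show p.1 = k from h2) (show p.1 < k from h1).ne
    · exact h2
  have hm := indep_iSup_of_disjoint (fun a => by
    rcases a with p | j
    · exact (hξ p.1 p.2).comap_le
    · exact (hU j).comap_le) h.iIndep hd
  have hle {s : Set ((ℕ × Fin N) ⊕ ℕ)} {a} (ha : a ∈ s) :
      Measurable[⨆ b ∈ s, MeasurableSpace.comap
        (Sum.elim (fun p : ℕ × Fin N => ξ p.1 p.2) U b) inferInstance]
        (Sum.elim (fun p : ℕ × Fin N => ξ p.1 p.2) U a) :=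
    (comap_measurable _).mono (le_biSup (fun b => MeasurableSpace.comap
        (Sum.elim (fun p : ℕ × Fin N => ξ p.1 p.2) U b) inferInstance) ha) le_rfl
  rw [IndepFun_iff_Indep]
  refine indep_of_indep_of_le_left (indep_of_indep_of_le_right hm ?_) ?_
  · refine Measurable.comap_le ?_
    refine @measurable_pi_lambda _ _ _ (_) _ _ fun i => ?_
    exact hle (s := pres) (a := Sum.inl (k, i)) rfl
  · refine Measurable.comap_le ?_
    refine @measurable_chain _ _ _ _ _ hA ℓ x₀ N Ω (_) ξ U k ?_ ?_
    · exact fun j hj i => hle (s := past) (a := Sum.inl (j, i)) hj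
    · exact fun j hj => hle (s := past) (a := Sum.inr j) hj

end Controlled
end Model

/-! ### Moments of the Gaussian noise -/

section Gaussian

variable {Ω : Type*} [MeasurableSpace Ω] {P : Measure Ω}

theorem memLp_of_hasLaw_gaussian {η : Ω → ℝ} (h : HasLaw η (gaussianReal 0 1) P) (p : NNReal) :
    MemLp η p P := by
  have h1 := memLp_id_gaussianReal (μ := 0) (v := 1) p
  rw [← h.map_eq] at h1
  exact h1.comp_of_map h.aemeasurable

theorem memLp_sq_of_hasLaw_gaussian {η : Ω → ℝ} (h : HasLaw η (gaussianReal 0 1) P) :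
    MemLp (fun ω => η ω ^ 2) 2 P := by
  rw [memLp_two_iff_integrable_sq (h.aemeasurable.pow_const 2).aestronglyMeasurable]
  refine ((memLp_of_hasLaw_gaussian h 4).integrable_norm_pow (by norm_num)).congr
    (Eventually.of_forall fun ω => ?_)
  simp only [Real.norm_eq_abs, ← pow_mul]
  exact Even.pow_abs (by decide) _

theorem integral_sq_of_hasLaw_gaussian {η : Ω → ℝ} (h : HasLaw η (gaussianReal 0 1) P) :
    ∫ ω, η ω ^ 2 ∂P = 1 := by
  have h1 := h.variance_eq
  rw [variance_id_gaussianReal, variance_of_integral_eq_zero h.aemeasurable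
    (by rw [h.integral_eq, integral_id_gaussianReal])] at h1
  simpa using h1

theorem integral_mul_of_gaussian {ι : Type*} [DecidableEq ι] {η : ι → Ω → ℝ}
    (h : ∀ i, HasLaw (η i) (gaussianReal 0 1) P) (hind : iIndepFun η P) (i j : ι) :
    ∫ ω, η i ω * η j ω ∂P = if i = j then 1 else 0 := by
  split_ifs with hij
  · subst hij
    simpa [sq] using integral_sq_of_hasLaw_gaussian (h i)
  · rw [(hind.indepFun hij).integral_fun_mul_eq_mul_integral
      (h i).aemeasurable.aestronglyMeasurable (h j).aemeasurable.aestronglyMeasurable,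
      (h i).integral_eq, integral_id_gaussianReal, zero_mul]

/-- The variance of the square of a standard Gaussian variable. -/
noncomputable def gaussianSqVar : ℝ := Var[fun x => x ^ 2; gaussianReal 0 1]

theorem gaussianSqVar_nonneg : 0 ≤ gaussianSqVar := variance_nonneg _ _

theorem integral_sum_sq_sub_sq [IsProbabilityMeasure P] {N : ℕ} {η : Fin N → Ω → ℝ}
    (h : ∀ i, HasLaw (η i) (gaussianReal 0 1) P) (hind : iIndepFun η P) :
    Integrable (fun ω => (∑ i, η i ω ^ 2 - N) ^ 2) P ∧
      ∫ ω, (∑ i, η i ω ^ 2 - N) ^ 2 ∂P = N * gaussianSqVar := by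
  have hL (i : Fin N) := memLp_sq_of_hasLaw_gaussian (h i)
  have hsum : MemLp (fun ω => ∑ i, η i ω ^ 2) 2 P := memLp_finsetSum _ fun i _ => hL i
  refine ⟨(hsum.sub (memLp_const (N : ℝ))).integrable_sq, ?_⟩
  have hmean : ∫ ω, ∑ i, η i ω ^ 2 ∂P = N := by
    rw [integral_finsetSum _ fun i _ => (hL i).integrable one_le_two]
    simp [integral_sq_of_hasLaw_gaussian (h _)]
  have hvar := IndepFun.variance_sum (X := fun i ω => η i ω ^ 2) (s := Finset.univ)
    (fun i _ => hL i) (fun i _ j _ hij => (hind.indepFun hij).comp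
      (measurable_id.pow_const 2) (measurable_id.pow_const 2))
  have hfun : (∑ i, fun ω => η i ω ^ 2) = fun ω => ∑ i, η i ω ^ 2 := by
    ext ω; simp
  have hone (i : Fin N) : Var[fun ω => η i ω ^ 2; P] = gaussianSqVar := by
    rw [gaussianSqVar, ← (h i).map_eq, variance_map (by fun_prop) (h i).aemeasurable]
    rfl
  rw [hfun, variance_eq_integral hsum.aemeasurable, hmean] at hvar
  rw [hvar]
  simp [hone]

/-- If `Z` is independent of a vector `η` of uncorrelated variables of variance one, then `∑ Z_i η_i`
has second moment `E ‖Z‖²`. -/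
theorem integral_sum_mul_sq {N : ℕ} {Z η : Fin N → Ω → ℝ} (hZ : ∀ i, MemLp (Z i) 2 P)
    (hη : ∀ i, MemLp (η i) 2 P) (hη' : ∀ i j, ∫ ω, η i ω * η j ω ∂P = if i = j then 1 else 0)
    (hind : ∀ i j, IndepFun (fun ω => Z i ω * Z j ω) (fun ω => η i ω * η j ω) P) :
    Integrable (fun ω => (∑ i, Z i ω * η i ω) ^ 2) P ∧
      ∫ ω, (∑ i, Z i ω * η i ω) ^ 2 ∂P = ∫ ω, ∑ i, Z i ω ^ 2 ∂P := by
  have hexp : (fun ω => (∑ i, Z i ω * η i ω) ^ 2) =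
      fun ω => ∑ i, ∑ j, (Z i ω * Z j ω) * (η i ω * η j ω) := by
    ext ω
    rw [sq, Finset.sum_mul_sum]
    exact Finset.sum_congr rfl fun i _ => Finset.sum_congr rfl fun j _ => by ring
  have hZZ (i j : Fin N) : Integrable (fun ω => Z i ω * Z j ω) P := (hZ i).integrable_mul (hZ j)
  have hηη (i j : Fin N) : Integrable (fun ω => η i ω * η j ω) P := (hη i).integrable_mul (hη j)
  have hint (i j : Fin N) : Integrable (fun ω => (Z i ω * Z j ω) * (η i ω * η j ω)) P :=
    (hind i j).integrable_mul (hZZ i j) (hηη i j)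
  rw [hexp]
  refine ⟨integrable_finsetSum _ fun i _ => integrable_finsetSum _ fun j _ => hint i j, ?_⟩
  rw [integral_finsetSum _ fun i _ => integrable_finsetSum _ fun j _ => hint i j,
    integral_finsetSum _ fun i _ => (hZ i).integrable_sq]
  refine Finset.sum_congr rfl fun i _ => ?_
  rw [integral_finsetSum _ fun j _ => hint i j, Finset.sum_eq_single i]
  · rw [(hind i i).integral_fun_mul_eq_mul_integral (hZZ i i).1 (hηη i i).1, hη']
    simp [sq]
  · intro j _ hj
    rw [(hind i j).integral_fun_mul_eq_mul_integral (hZZ i j).1 (hηη i j).1, hη', if_neg hj.symm,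
      mul_zero]
  · simp

end Gaussian
end MALA

namespace MALA

/-! ### Growth of the expected energy -/

namespace Model

variable {H : Type*} [NormedAddCommGroup H] [InnerProductSpace ℝ H]

/-- Bound for the ratio of the expected noise energy to the expected energy. -/
noncomputable def noiseConst (A ℓ : ℝ) : ℝ := ℓ ^ 2 * (1 + gaussianSqVar) + 1 + A ^ 2

theorem abs_accept_sub_limitAccept_le_one (M : Model H) (ℓ σ : ℝ) {N : ℕ} (x y : Fin N → ℝ) :
    |M.accept ℓ x y - limitAccept ℓ σ| ≤ 1 := by
  have h1 : 0 ≤ M.accept ℓ x y := by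
    unfold accept targetDensity proposalDensity; positivity
  have h2 : M.accept ℓ x y ≤ 1 := min_le_left _ _
  have h3 : 0 ≤ limitAccept ℓ σ := by unfold limitAccept; positivity
  have h4 : limitAccept ℓ σ ≤ 1 := min_le_left _ _
  exact abs_le.2 ⟨by linarith, by linarith⟩

theorem noiseConst_nonneg (A ℓ : ℝ) : 0 ≤ noiseConst A ℓ := by
  have := gaussianSqVar_nonneg
  rw [noiseConst]; positivity

namespace Controlled

variable {M : Model H} {A : ℝ} (hA : M.Controlled A)
include hA

/-- At a random position independent of the noise, the expected noise energy is bounded by a multiple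
of the expected energy. -/
theorem integral_noiseEnergy_le {Ω : Type*} [MeasurableSpace Ω] {P : Measure Ω}
    [IsProbabilityMeasure P] {ℓ : ℝ} {N : ℕ} (hN : N ≠ 0) (hδ : 0 < step ℓ N)
    {X : Ω → Fin N → ℝ} {η : Fin N → Ω → ℝ} (hX : Measurable X)
    (hη : ∀ i, HasLaw (η i) (gaussianReal 0 1) P) (hind : iIndepFun η P)
    (hXη : IndepFun X (fun ω i => η i ω) P)
    (hE : Integrable (fun ω => M.energy (step ℓ N) (X ω)) P) :
    Integrable (fun ω => M.noiseEnergy (step ℓ N) (X ω) fun i => η i ω) P ∧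
      ∫ ω, M.noiseEnergy (step ℓ N) (X ω) (fun i => η i ω) ∂P ≤
        noiseConst A ℓ * ∫ ω, M.energy (step ℓ N) (X ω) ∂P := by
  have hs := step_sq ℓ hN
  set δ := step ℓ N
  have hηsq (i : Fin N) : Integrable (fun ω => η i ω ^ 2) P :=
    (memLp_of_hasLaw_gaussian (hη i) 2).integrable_sq
  -- the squared norm of the noise
  have i1 : Integrable (fun ω => ∑ i, η i ω ^ 2) P := integrable_finsetSum _ fun i _ => hηsq i
  have e1 : ∫ ω, ∑ i, η i ω ^ 2 ∂P = N := by
    rw [integral_finsetSum _ fun i _ => hηsq i]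
    simp [integral_sq_of_hasLaw_gaussian (hη _)]
  -- the inner product of the position and the noise
  have hZm (i : Fin N) : Measurable fun ω => X ω i / M.lam i :=
    ((measurable_pi_apply i).comp hX).div_const _
  have hZle (i : Fin N) (ω : Ω) : δ ^ 2 * (X ω i / M.lam i) ^ 2 ≤ M.energy δ (X ω) := by
    have h1 : (X ω i / M.lam i) ^ 2 ≤ ‖M.white (X ω)‖ ^ 2 := by
      rw [← normSqCN_eq, normSqCN, div_pow]
      exact Finset.single_le_sum (f := fun i => X ω i ^ 2 / M.lam i ^ 2)
        (fun i _ => by positivity) (Finset.mem_univ i)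
    have h2 := mul_le_mul_of_nonneg_left h1 (sq_nonneg δ)
    have h3 : 0 ≤ δ * ‖M.embed (X ω)‖ ^ 2 := by positivity
    rw [energy]
    linarith
  have hZ (i : Fin N) : MemLp (fun ω => X ω i / M.lam i) 2 P := by
    rw [memLp_two_iff_integrable_sq (hZm i).aestronglyMeasurable]
    refine (hE.div_const (δ ^ 2)).mono' ((hZm i).pow_const 2).aestronglyMeasurable
      (Eventually.of_forall fun ω => ?_)
    rw [Real.norm_of_nonneg (by positivity), le_div_iff₀ (by positivity), mul_comm]
    exact hZle i ω
  obtain ⟨i2, e2⟩ := integral_sum_mul_sq hZ (fun i => memLp_of_hasLaw_gaussian (hη i) 2)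
    (integral_mul_of_gaussian hη hind) fun i j => by
      have h1 : Measurable fun x : Fin N → ℝ => (x i / M.lam i) * (x j / M.lam j) := by fun_prop
      have h2 : Measurable fun x : Fin N → ℝ => x i * x j := by fun_prop
      exact hXη.comp h1 h2
  obtain ⟨i3, e3⟩ := integral_sum_sq_sub_sq hη hind
  -- the norm of the noise in `H^s`
  have i4 (i : Fin N) :
      Integrable (fun ω => ((i : ℝ) + 1) ^ (2 * M.s) * (M.lam i * η i ω) ^ 2) P := by
    simp only [mul_pow]
    exact ((hηsq i).const_mul _).const_mul _
  have e4 : ∫ ω, ∑ i : Fin N, ((i : ℝ) + 1) ^ (2 * M.s) * (M.lam i * η i ω) ^ 2 ∂P ≤ A ^ 2 := by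
    rw [integral_finsetSum _ fun i _ => i4 i]
    refine le_of_eq_of_le (Finset.sum_congr rfl fun i _ => ?_) (hA.trace N)
    simp only [mul_pow, integral_const_mul, integral_sq_of_hasLaw_gaussian (hη i), mul_one]
  have hnoise : (fun ω => M.noiseEnergy δ (X ω) fun i => η i ω) = fun ω =>
      δ ^ 2 * (∑ i, η i ω ^ 2 + (∑ i, X ω i / M.lam i * η i ω) ^ 2
        + (∑ i, η i ω ^ 2 - N) ^ 2)
      + ∑ i : Fin N, ((i : ℝ) + 1) ^ (2 * M.s) * (M.lam i * η i ω) ^ 2 := by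
    ext ω
    simp only [noiseEnergy, norm_sq_embed, sqrtCN, EuclideanSpace.norm_sq_eq, white,
      EuclideanSpace.inner_toLp_toLp, dotProduct, Pi.star_apply, star_trivial, Real.norm_eq_abs,
      sq_abs, mul_comm (η _ ω)]
  have i5 := integrable_finsetSum Finset.univ fun i _ => i4 i
  rw [hnoise]
  have i12 := i1.fun_add i2
  have i123 := i12.fun_add i3
  refine ⟨(i123.const_mul _).fun_add i5, ?_⟩
  rw [integral_add (i123.const_mul _) i5, integral_const_mul, integral_add i12 i3,
    integral_add i1 i2, e1, e2, e3]
  have h1 : 1 ≤ ∫ ω, M.energy δ (X ω) ∂P := by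
    have := integral_mono (integrable_const (1 : ℝ)) hE fun ω => M.one_le_energy hδ.le (X ω)
    simpa using this
  have h2 : δ ^ 2 * ∫ ω, ∑ i, (X ω i / M.lam i) ^ 2 ∂P ≤ ∫ ω, M.energy δ (X ω) ∂P := by
    rw [← integral_const_mul]
    refine integral_mono ((integrable_finsetSum _ fun i _ => (hZ i).integrable_sq).const_mul _) hE
      fun ω => ?_
    have h3 : 0 ≤ δ * ‖M.embed (X ω)‖ ^ 2 := by positivity
    simp only [energy, ← normSqCN_eq, normSqCN, div_pow]
    linarith
  have hv := gaussianSqVar_nonneg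
  have h3 : ℓ ^ 2 * (1 + gaussianSqVar) + A ^ 2 ≤
      (ℓ ^ 2 * (1 + gaussianSqVar) + A ^ 2) * ∫ ω, M.energy δ (X ω) ∂P :=
    le_mul_of_one_le_right (by positivity) h1
  have h4 : δ ^ 2 * (N + ∫ ω, ∑ i, (X ω i / M.lam i) ^ 2 ∂P + N * gaussianSqVar) =
      ℓ ^ 2 * (1 + gaussianSqVar) + δ ^ 2 * ∫ ω, ∑ i, (X ω i / M.lam i) ^ 2 ∂P := by
    rw [← hs]; ring
  rw [h4, noiseConst]
  linarith

section Chain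

variable {Ω : Type*} [MeasurableSpace Ω] {P : Measure Ω} [IsProbabilityMeasure P] {N : ℕ}
  {ξ : ℕ → Fin N → Ω → ℝ} {U : ℕ → Ω → ℝ}

theorem integral_noiseEnergy_chain_le (hnoise : IsNoise P ξ U) (hξ : ∀ k i, Measurable (ξ k i))
    (hU : ∀ k, Measurable (U k)) {ℓ : ℝ} (hN : N ≠ 0) (hδ : 0 < step ℓ N) (x₀ : Hs M.φ M.s) (k : ℕ)
    (hE : Integrable (fun ω => M.energy (step ℓ N) (M.chain ℓ x₀ ξ U k ω)) P) :
    Integrable (fun ω =>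
        M.noiseEnergy (step ℓ N) (M.chain ℓ x₀ ξ U k ω) fun i => ξ k i ω) P ∧
      ∫ ω, M.noiseEnergy (step ℓ N) (M.chain ℓ x₀ ξ U k ω) (fun i => ξ k i ω) ∂P ≤
        noiseConst A ℓ * ∫ ω, M.energy (step ℓ N) (M.chain ℓ x₀ ξ U k ω) ∂P := by
  have hind : iIndepFun (ξ k) P :=
    hnoise.indep.precomp (g := fun i : Fin N => Sum.inl (k, i)) fun i j h => by simpa using h
  exact hA.integral_noiseEnergy_le hN hδ (hA.measurable_chain ℓ x₀ k (fun j _ => hξ j)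
    fun j _ => hU j) (hnoise.gaussian k) hind (hA.indepFun_chain ℓ x₀ hξ hU hnoise.indep k) hE

/-- Discrete Gronwall estimate for the expected energy. No independence of the acceptance step is
needed, as the energy after it is at most the bound for the energy of the proposal. -/
theorem integral_energy_chain_le (hnoise : IsNoise P ξ U) (hξ : ∀ k i, Measurable (ξ k i))
    (hU : ∀ k, Measurable (U k)) {ℓ : ℝ} (hN : N ≠ 0) (hδ : 0 < step ℓ N) (hδ1 : step ℓ N ≤ 1)
    (x₀ : Hs M.φ M.s) (k : ℕ) :
    Integrable (fun ω => M.energy (step ℓ N) (M.chain ℓ x₀ ξ U k ω)) P ∧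
      ∫ ω, M.energy (step ℓ N) (M.chain ℓ x₀ ξ U k ω) ∂P ≤
        (1 + 16 * A ^ 6 * (1 + noiseConst A ℓ) * step ℓ N) ^ k
          * M.energy (step ℓ N) (M.proj N x₀) := by
  have hA1 := hA.one_le
  have hB := noiseConst_nonneg A ℓ
  induction k with
  | zero => simp [chain]
  | succ k ih =>
    obtain ⟨ihi, ihe⟩ := ih
    obtain ⟨hni, hne⟩ := hA.integral_noiseEnergy_chain_le hnoise hξ hU hN hδ x₀ k ihi
    set δ := step ℓ N
    have hstep (ω : Ω) : M.energy δ (M.chain ℓ x₀ ξ U (k + 1) ω) ≤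
        M.energy δ (M.chain ℓ x₀ ξ U k ω) + 16 * A ^ 6 * δ * (M.energy δ (M.chain ℓ x₀ ξ U k ω)
          + M.noiseEnergy δ (M.chain ℓ x₀ ξ U k ω) fun i => ξ k i ω) := by
      simp only [chain_succ]
      split_ifs
      · exact hA.energy_proposal_le hδ hδ1 _ _
      · have h1 := M.one_le_energy hδ.le (M.chain ℓ x₀ ξ U k ω)
        have h2 := M.noiseEnergy_nonneg δ (M.chain ℓ x₀ ξ U k ω) fun i => ξ k i ω
        have : 0 ≤ 16 * A ^ 6 * δ * (M.energy δ (M.chain ℓ x₀ ξ U k ω)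
          + M.noiseEnergy δ (M.chain ℓ x₀ ξ U k ω) fun i => ξ k i ω) :=
          mul_nonneg (by positivity) (by linarith)
        linarith
    have hsum := (ihi.fun_add hni).const_mul (16 * A ^ 6 * δ)
    have hint := ihi.fun_add hsum
    have hm : Measurable fun ω => M.energy δ (M.chain ℓ x₀ ξ U (k + 1) ω) :=
      (M.measurable_energy δ N).comp (hA.measurable_chain ℓ x₀ (k + 1) (fun j _ => hξ j)
        fun j _ => hU j)
    have hi : Integrable (fun ω => M.energy δ (M.chain ℓ x₀ ξ U (k + 1) ω)) P := by
      refine hint.mono' hm.aestronglyMeasurable (Eventually.of_forall fun ω => ?_)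
      rw [Real.norm_of_nonneg (zero_le_one.trans (M.one_le_energy hδ.le _))]
      exact hstep ω
    refine ⟨hi, (integral_mono hi hint hstep).trans ?_⟩
    rw [integral_add ihi hsum, integral_const_mul, integral_add ihi hni]
    set e := ∫ ω, M.energy δ (M.chain ℓ x₀ ξ U k ω) ∂P
    calc _ ≤ e + 16 * A ^ 6 * δ * (e + noiseConst A ℓ * e) := by gcongr
      _ = (1 + 16 * A ^ 6 * (1 + noiseConst A ℓ) * δ) * e := by ring
      _ ≤ (1 + 16 * A ^ 6 * (1 + noiseConst A ℓ) * δ) *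
          ((1 + 16 * A ^ 6 * (1 + noiseConst A ℓ) * δ) ^ k * M.energy δ (M.proj N x₀)) := by
        gcongr
      _ = _ := by ring

/-- The mean squared error is at most of order `√δ`, uniformly over `O(1/δ)` steps. -/
theorem integral_sq_error_le (hnoise : IsNoise P ξ U) (hξ : ∀ k i, Measurable (ξ k i))
    (hU : ∀ k, Measurable (U k)) {ℓ : ℝ} (hN : N ≠ 0) (hδ : 0 < step ℓ N) (hδ1 : step ℓ N ≤ 1)
    (x₀ : Hs M.φ M.s) {k : ℕ} {τ : ℝ} (hk : k * step ℓ N ≤ τ) :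
    ∫ ω, |M.accept ℓ (M.chain ℓ x₀ ξ U k ω) (M.chainProposal ℓ x₀ ξ U k ω)
      - limitAccept ℓ (M.S (M.chain ℓ x₀ ξ U k ω))| ^ 2 ∂P ≤
    240 * A ^ 10 * (1 + noiseConst A ℓ) * Real.exp (16 * A ^ 6 * (1 + noiseConst A ℓ) * τ)
      * M.energy (step ℓ N) (M.proj N x₀) * √(step ℓ N) := by
  have hA1 := hA.one_le
  have hB := noiseConst_nonneg A ℓ
  obtain ⟨hei, hee⟩ := hA.integral_energy_chain_le hnoise hξ hU hN hδ hδ1 x₀ k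
  obtain ⟨hni, hne⟩ := hA.integral_noiseEnergy_chain_le hnoise hξ hU hN hδ x₀ k hei
  set δ := step ℓ N
  have h0 : 0 ≤ M.energy δ (M.proj N x₀) := zero_le_one.trans (M.one_le_energy hδ.le _)
  have hpow : (1 + 16 * A ^ 6 * (1 + noiseConst A ℓ) * δ) ^ k ≤
      Real.exp (16 * A ^ 6 * (1 + noiseConst A ℓ) * τ) := by
    calc _ ≤ Real.exp (16 * A ^ 6 * (1 + noiseConst A ℓ) * δ) ^ k := by
          gcongr
          rw [add_comm]
          exact Real.add_one_le_exp _
      _ = Real.exp (16 * A ^ 6 * (1 + noiseConst A ℓ) * (k * δ)) := by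
          rw [← Real.exp_nat_mul]; ring_nf
      _ ≤ _ := by gcongr
  have hpt (ω : Ω) : |M.accept ℓ (M.chain ℓ x₀ ξ U k ω) (M.chainProposal ℓ x₀ ξ U k ω)
      - limitAccept ℓ (M.S (M.chain ℓ x₀ ξ U k ω))| ^ 2 ≤
      240 * A ^ 10 * √δ * (M.energy δ (M.chain ℓ x₀ ξ U k ω)
        + M.noiseEnergy δ (M.chain ℓ x₀ ξ U k ω) fun i => ξ k i ω) := by
    refine le_trans ?_ (hA.abs_accept_sub_le hN hδ hδ1 _ _)
    exact pow_le_of_le_one (abs_nonneg _) (abs_accept_sub_limitAccept_le_one M ℓ _ _ _) two_ne_zero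
  have hint := (hei.fun_add hni).const_mul (240 * A ^ 10 * √δ)
  refine (integral_mono_of_nonneg (Eventually.of_forall fun ω => by positivity) hint
    (Eventually.of_forall hpt)).trans ?_
  rw [integral_const_mul, integral_add hei hni]
  set e := ∫ ω, M.energy δ (M.chain ℓ x₀ ξ U k ω) ∂P
  calc _ ≤ 240 * A ^ 10 * √δ * (e + noiseConst A ℓ * e) := by gcongr
    _ = 240 * A ^ 10 * √δ * (1 + noiseConst A ℓ) * e := by ring
    _ ≤ 240 * A ^ 10 * √δ * (1 + noiseConst A ℓ) *
        (Real.exp (16 * A ^ 6 * (1 + noiseConst A ℓ) * τ) * M.energy δ (M.proj N x₀)) := by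
      gcongr
      exact hee.trans (by gcongr)
    _ = _ := by ring

end Chain
end Controlled
end Model
end MALA

namespace MALA

/-! ### Modification of the noise on a null set -/

/-- The noise variables, which are only almost everywhere measurable, can be replaced by measurable
ones without changing the chain outside a null set. -/
theorem IsNoise.exists_measurable {Ω : Type*} [MeasurableSpace Ω] {P : Measure Ω} {N : ℕ}
    {ξ : ℕ → Fin N → Ω → ℝ} {U : ℕ → Ω → ℝ} (h : IsNoise P ξ U) :
    ∃ (ξ' : ℕ → Fin N → Ω → ℝ) (U' : ℕ → Ω → ℝ), IsNoise P ξ' U' ∧ (∀ k i, Measurable (ξ' k i)) ∧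
      (∀ k, Measurable (U' k)) ∧ ∀ᵐ ω ∂P, (∀ k i, ξ k i ω = ξ' k i ω) ∧ ∀ k, U k ω = U' k ω := by
  have hξ (k : ℕ) (i : Fin N) := (h.gaussian k i).aemeasurable
  have hU (k : ℕ) := (h.uniform k).aemeasurable
  refine ⟨fun k i => (hξ k i).mk, fun k => (hU k).mk, ⟨fun k i => ?_, fun k => ?_, ?_⟩,
    fun k i => (hξ k i).measurable_mk, fun k => (hU k).measurable_mk, ?_⟩
  · exact (h.gaussian k i).congr (hξ k i).ae_eq_mk.symm
  · exact (h.uniform k).congr (hU k).ae_eq_mk.symm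
  · refine h.indep.congr ?_
    rintro (p | k)
    · exact (hξ p.1 p.2).ae_eq_mk
    · exact (hU k).ae_eq_mk
  · have h1 := ae_all_iff.2 fun k => ae_all_iff.2 fun i => (hξ k i).ae_eq_mk
    have h2 := ae_all_iff.2 fun k => (hU k).ae_eq_mk
    filter_upwards [h1, h2] with ω h1 h2 using ⟨h1, h2⟩

namespace Model

variable {H : Type*} [NormedAddCommGroup H] [InnerProductSpace ℝ H]

theorem chain_congr (M : Model H) (ℓ : ℝ) (x₀ : Hs M.φ M.s) {N : ℕ} {Ω : Type*}
    {ξ ξ' : ℕ → Fin N → Ω → ℝ} {U U' : ℕ → Ω → ℝ} {ω : Ω} (hξ : ∀ k i, ξ k i ω = ξ' k i ω)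
    (hU : ∀ k, U k ω = U' k ω) (k : ℕ) : M.chain ℓ x₀ ξ U k ω = M.chain ℓ x₀ ξ' U' k ω := by
  induction k with
  | zero => rfl
  | succ k ih => simp only [chain_succ, ih, hξ, hU]

theorem chainProposal_congr (M : Model H) (ℓ : ℝ) (x₀ : Hs M.φ M.s) {N : ℕ} {Ω : Type*}
    {ξ ξ' : ℕ → Fin N → Ω → ℝ} {U U' : ℕ → Ω → ℝ} {ω : Ω} (hξ : ∀ k i, ξ k i ω = ξ' k i ω)
    (hU : ∀ k, U k ω = U' k ω) (k : ℕ) :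
    M.chainProposal ℓ x₀ ξ U k ω = M.chainProposal ℓ x₀ ξ' U' k ω := by
  simp only [chainProposal, M.chain_congr ℓ x₀ hξ hU, hξ]

theorem Controlled.integrable_sq_error {M : Model H} {A : ℝ} (hA : M.Controlled A) {Ω : Type*}
    [MeasurableSpace Ω] {P : Measure Ω} [IsProbabilityMeasure P] {N : ℕ}
    {ξ : ℕ → Fin N → Ω → ℝ} {U : ℕ → Ω → ℝ} (hξ : ∀ k i, Measurable (ξ k i))
    (hU : ∀ k, Measurable (U k)) (ℓ : ℝ) (x₀ : Hs M.φ M.s) (k : ℕ) :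
    Integrable (fun ω => |M.accept ℓ (M.chain ℓ x₀ ξ U k ω) (M.chainProposal ℓ x₀ ξ U k ω)
      - limitAccept ℓ (M.S (M.chain ℓ x₀ ξ U k ω))| ^ 2) P := by
  have hx := hA.measurable_chain ℓ x₀ k (fun j _ => hξ j) fun j _ => hU j
  have hy := hA.measurable_chainProposal ℓ x₀ hξ hU k
  have h1 := (hA.measurable_accept ℓ N).comp (hx.prodMk hy)
  have h2 : Measurable (limitAccept ℓ) := by
    unfold limitAccept
    fun_prop
  have h3 := h2.comp ((M.measurable_S N).comp hx)
  simp only [Function.comp_def] at h1 h3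
  refine (integrable_const (1 : ℝ)).mono' ((h1.sub h3).abs.pow_const 2).aestronglyMeasurable
    (Eventually.of_forall fun ω => ?_)
  rw [Real.norm_of_nonneg (by positivity)]
  exact pow_le_one₀ (abs_nonneg _) (abs_accept_sub_limitAccept_le_one M ℓ _ _ _)

/-- The initial energy stays bounded as `N → ∞`. -/
theorem InHsCap.eventually_energy_le {M : Model H} {x₀ : Hs M.φ M.s} (hx₀ : M.InHsCap x₀) {ℓ : ℝ}
    (hℓ : 0 < ℓ) : ∃ R, ∀ᶠ N : ℕ in atTop, step ℓ N ≤ 1 →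
      M.energy (step ℓ N) (M.proj N x₀) ≤ R := by
  obtain ⟨S₀, hS⟩ := hx₀
  refine ⟨1 + ℓ ^ 2 * (S₀ + 1) + ‖x₀‖ ^ 2, ?_⟩
  filter_upwards [hS.eventually_le_const (lt_add_one S₀), eventually_ne_atTop 0] with N h1 hN hδ1
  have h2 : step ℓ N ^ 2 * ‖M.white (M.proj N x₀)‖ ^ 2 ≤ ℓ ^ 2 * (S₀ + 1) := by
    have hN' : (N : ℝ) ≠ 0 := by exact_mod_cast hN
    refine le_trans (le_of_eq ?_) (mul_le_mul_of_nonneg_left h1 (sq_nonneg ℓ))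
    rw [← step_sq ℓ hN, ← normSqCN_eq, normSqCN]
    simp only [proj]
    field_simp
  have hδ0 : 0 ≤ step ℓ N := by unfold step; positivity
  have h3 : step ℓ N * ‖M.embed (M.proj N x₀)‖ ^ 2 ≤ 1 * ‖x₀‖ ^ 2 := by
    gcongr
    exact M.norm_embed_proj_le N x₀
  rw [energy]
  linarith

theorem tendsto_step (ℓ : ℝ) : Tendsto (step ℓ) atTop (𝓝 0) :=
  tendsto_const_nhds.div_atTop (Real.tendsto_sqrt_atTop.comp tendsto_natCast_atTop_atTop)

end Model
end MALA

/-! ### Convergence of the acceptance probability -/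

theorem proposition6p4 {H : Type*} [NormedAddCommGroup H] [InnerProductSpace ℝ H] [CompleteSpace H]
    (M : MALA.Model H) (hM : M.Assumption)
    (ℓ : ℝ) (hℓ : 0 < ℓ)
    (x₀ : MALA.Hs M.φ M.s) (hx₀ : M.InHsCap x₀)
    {Ω : ℕ → Type*} [∀ N, MeasurableSpace (Ω N)]
    (P : ∀ N, Measure (Ω N)) [∀ N, IsProbabilityMeasure (P N)]
    (ξ : ∀ N : ℕ, ℕ → Fin N → Ω N → ℝ) (U : ∀ N : ℕ, ℕ → Ω N → ℝ)
    (hnoise : ∀ N, MALA.IsNoise (P N) (ξ N) (U N)) :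
    (∀ N k : ℕ, Integrable (fun ω =>
        |M.accept ℓ (M.chain ℓ x₀ (ξ N) (U N) k ω) (M.chainProposal ℓ x₀ (ξ N) (U N) k ω)
          - MALA.limitAccept ℓ (M.S (M.chain ℓ x₀ (ξ N) (U N) k ω))| ^ 2) (P N)) ∧
    ∀ T : ℝ, 0 < T →
      Tendsto (fun N : ℕ => ⨆ k : Fin (⌊T * √(N : ℝ)⌋₊ + 1), ∫ ω,
        |M.accept ℓ (M.chain ℓ x₀ (ξ N) (U N) k ω) (M.chainProposal ℓ x₀ (ξ N) (U N) k ω)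
          - MALA.limitAccept ℓ (M.S (M.chain ℓ x₀ (ξ N) (U N) k ω))| ^ 2 ∂(P N))
        atTop (𝓝 0) := by
  obtain ⟨A, hA⟩ := hM.exists_controlled
  choose ξ' U' hnoise' hξ' hU' hae using fun N => (hnoise N).exists_measurable
  have hcongr (N k : ℕ) : (fun ω =>
      |M.accept ℓ (M.chain ℓ x₀ (ξ N) (U N) k ω) (M.chainProposal ℓ x₀ (ξ N) (U N) k ω)
        - MALA.limitAccept ℓ (M.S (M.chain ℓ x₀ (ξ N) (U N) k ω))| ^ 2) =ᵐ[P N] fun ω =>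
      |M.accept ℓ (M.chain ℓ x₀ (ξ' N) (U' N) k ω) (M.chainProposal ℓ x₀ (ξ' N) (U' N) k ω)
        - MALA.limitAccept ℓ (M.S (M.chain ℓ x₀ (ξ' N) (U' N) k ω))| ^ 2 := by
    filter_upwards [hae N] with ω hω
    rw [M.chain_congr ℓ x₀ hω.1 hω.2, M.chainProposal_congr ℓ x₀ hω.1 hω.2]
  refine ⟨fun N k => (hA.integrable_sq_error (hξ' N) (hU' N) ℓ x₀ k).congr (hcongr N k).symm,
    fun T hT => ?_⟩
  simp only [fun N k => integral_congr_ae (hcongr N k)]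
  have hδ0 := MALA.Model.tendsto_step ℓ
  obtain ⟨R, hR⟩ := hx₀.eventually_energy_le hℓ
  have hA1 := hA.one_le
  have hB := MALA.Model.noiseConst_nonneg A ℓ
  set C := 240 * A ^ 10 * (1 + MALA.Model.noiseConst A ℓ) *
    Real.exp (16 * A ^ 6 * (1 + MALA.Model.noiseConst A ℓ) * (ℓ * T))
  have hlim : Tendsto (fun N : ℕ => C * R * √(MALA.Model.step ℓ N)) atTop (𝓝 0) := by
    simpa using (hδ0.sqrt).const_mul (C * R)
  refine squeeze_zero' (Eventually.of_forall fun N => Real.iSup_nonneg fun k =>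
    integral_nonneg fun ω => by positivity) ?_ hlim
  filter_upwards [hR, hδ0.eventually_le_const zero_lt_one, eventually_ne_atTop 0] with N hRN hδ1 hN
  have hsN : 0 < √(N : ℝ) := Real.sqrt_pos.2 (by exact_mod_cast Nat.pos_of_ne_zero hN)
  have hδ : 0 < MALA.Model.step ℓ N := div_pos hℓ hsN
  refine ciSup_le fun k => ?_
  have hk : ((k : ℕ) : ℝ) * MALA.Model.step ℓ N ≤ ℓ * T := by
    have h1 : ((k : ℕ) : ℝ) ≤ T * √(N : ℝ) :=
      (Nat.cast_le.2 (Nat.lt_succ_iff.1 k.2)).trans (Nat.floor_le (by positivity))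
    calc ((k : ℕ) : ℝ) * MALA.Model.step ℓ N ≤ T * √(N : ℝ) * (ℓ / √(N : ℝ)) := by
          rw [MALA.Model.step]; gcongr
      _ = ℓ * T := by field_simp
  refine (hA.integral_sq_error_le (hnoise' N) (hξ' N) (hU' N) hN hδ hδ1 x₀ hk).trans ?_
  gcongr
  exact hRN hδ1
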